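/- Let $\rho>0$ and let $q$ be the $Q$-matrix of the $M/M/\infty$ queue on $\mathbb N=\{0,1,2,\dots\}$: $q(x,x+1)=\rho$ and $q(x,x-1)=x$, all other off-diagonal entries being $0$; put $q_x=\sum_{y\neq x}q(x,y)=\rho+x$ and $p(x,y)=q(x,y)/q_x$ for $y\ne x$, $p(x,x)=0$. Let $(C(t),M(t))_{t\ge 0}$ be the associated cat and mouse process, that is, the continuous-time Markov chain on $\mathbb N^2$ with the following jump rates: from $(x,y)$ with $x\neq y$ it jumps to $(z,y)$, $z\neq x$, at rate $q(x,z)$ (only the cat $C$ moves), and from $(x,x)$ it jumps to $(z,z')$ at rate $q_x\,p(x,z)\,p(x,z')$ (the cat and the mouse jump simultaneously and independently). Suppose that $C(0)=M(0)=n$ and let $$T_0=\inf\{s>0: C(s)=0\}.$$ Then $T_0<\infty$ almost surely for every $n$ and, as $n\to\infty$, the random variable $M(T_0)/n$ converges in distribution to a random variable $F$ on $[0,1]$ such that $\mathbb P(F\le x)=x^{\rho}$ for all $x\in[0,1]$. -/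

import Mathlib

open MeasureTheory ProbabilityTheory Filter Topology
open scoped NNReal ENNReal

noncomputable section

namespace CatMouse

open scoped Classical in
/-- The total jump rate `q_x = ∑_{y ≠ x} q(x, y)` out of the state `x`, for a matrix `q` of jump
rates on a discrete state space. The diagonal entries of `q` play no role. -/
def exitRate {S : Type*} (q : S → S → ℝ) (x : S) : ℝ :=
  ∑' y, if y = x then 0 else q x y

open scoped Classical in
/-- The transition matrix of the jump chain: `p(x, y) = q(x, y) / q_x` for `y ≠ x` and
`p(x, x) = 0`, except that a state with `q_x = 0` is absorbing. -/
def jumpProb {S : Type*} (q : S → S → ℝ) (x y : S) : ℝ :=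
  if exitRate q x = 0 then (if y = x then 1 else 0)
  else if y = x then 0 else q x y / exitRate q x

/-- `X` is a continuous-time Markov chain with jump rates `q` started at `x₀`, in the jump
chain / holding time sense. With `Y k` the `k`-th state visited and `τ k` the time spent there:
`Y` is a discrete-time Markov chain with transition matrix `jumpProb q` started at `x₀`;
conditionally on `Y`, the `τ k` are independent and exponentially distributed with parameters
`exitRate q (Y k)` (infinite if the parameter is `0`); and almost surely `X` equals `Y k` from the
instant `τ 0 + ⋯ + τ (k - 1)` of the `k`-th jump until just before that of the next one. Nothing
is required of `X` after a possible explosion. -/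
def IsMarkovJumpProcess {S : Type*} [MeasurableSpace S] (q : S → S → ℝ) (x₀ : S)
    {Ω : Type*} [MeasurableSpace Ω] (P : Measure Ω) (X : ℝ≥0 → Ω → S) : Prop :=
  ∃ (Y : ℕ → Ω → S) (τ : ℕ → Ω → ℝ≥0∞),
    (∀ k, Measurable (Y k)) ∧ (∀ k, Measurable (τ k)) ∧
    (∀ᵐ ω ∂P, Y 0 ω = x₀) ∧
    (∀ (n : ℕ) (y : ℕ → S) (t : ℕ → ℝ≥0), y 0 = x₀ →
      P.real {ω | ∀ k ≤ n, Y k ω = y k ∧ (t k : ℝ≥0∞) < τ k ω} =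
        (∏ k ∈ Finset.range n, jumpProb q (y k) (y (k + 1))) *
          ∏ k ∈ Finset.range (n + 1), Real.exp (-(exitRate q (y k) * t k))) ∧
    (∀ᵐ ω ∂P, ∀ (k : ℕ) (t : ℝ≥0),
      (∑ i ∈ Finset.range k, τ i ω) ≤ t → (t : ℝ≥0∞) < ∑ i ∈ Finset.range (k + 1), τ i ω →
        X t ω = Y k ω)

open scoped Classical in
/-- The jump rates of the cat and mouse process `(C, M)` on `S × S` attached to the rates `q`.
Off the diagonal the cat alone moves, with rates `q`; from `(x, x)`, at rate `q_x`, the two jump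
simultaneously and independently, each according to `p(x, ·)`. -/
def catMouseRate {S : Type*} (q : S → S → ℝ) (a b : S × S) : ℝ :=
  if a.1 = a.2 then exitRate q a.1 * (jumpProb q a.1 b.1 * jumpProb q a.1 b.2)
  else if b.2 = a.2 then q a.1 b.1 else 0

/-- The jump rates of the `M/M/∞` queue with arrival rate `ρ` and service rate `1`:
`q(x, x + 1) = ρ` and `q(x, x - 1) = x`. -/
def mmInftyRate (ρ : ℝ) (x y : ℕ) : ℝ :=
  if y = x + 1 then ρ else if y + 1 = x then (x : ℝ) else 0

/-- The hitting time `T₀ = inf {s > 0 : C(s) = 0}` of `0` by the first coordinate `C` of `X`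
(with the junk value `0` on paths for which `C` never vanishes at a positive time). -/
def catHitZero {Ω : Type*} (X : ℝ≥0 → Ω → ℕ × ℕ) (ω : Ω) : ℝ≥0 :=
  sInf {s : ℝ≥0 | 0 < s ∧ (X s ω).1 = 0}

end CatMouse

end

/-! Only meetings of cat and mouse matter. After a meeting at `n` the mouse goes down with
probability `n / (ρ + n)`; wherever the cat went, its unit steps force it to meet the mouse at `n -
1` before it can pass below, so the next meeting is there. With probability `ρ / (ρ + n)` the mouse
goes up. Then, unless the cat goes up too or climbs from `n - 1` to `n + 1` before visiting `0`, the
mouse stays at `n + 1` until the end. These exceptions have vanishing conditional probability: the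
climb has probability `upProb ρ n`, which tends to `0` (`tendsto_upProb`). So the mouse ends at or
below `m` with probability close to `∏ j / (ρ + j)` over `m < j ≤ n`, that is `growth ρ m / growth ρ
n`, and Euler's product for `Γ` turns this into `(m / n) ^ ρ`.

The rigorous form uses barriers instead of the chain of meetings. A function `G` of the meeting
point and a terminal cost `f` of the final position of the mouse are extended to all pairs by
`diagExtension`, harmonically for the cat. Superharmonicity then reduces to one inequality on the
diagonal, `IsDiagSuperharmonic`, and optional stopping bounds the terminal law by `G n`
(`IsChain.measure_mouse_le`). The barriers `isDiagSuperharmonic_below` and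
`isDiagSuperharmonic_above` give matching bounds. The same argument with the Lyapunov function of
`exists_lyapunov` shows that the cat reaches `0`. -/

namespace CatMouse

/-! ### Stopped sequences -/

section Stopped

variable {S Ω : Type*} {Y : ℕ → Ω → S}

open scoped Classical in
/-- The chain `Y` frozen upon entering `A`. -/
noncomputable def stopped (A : Set S) (Y : ℕ → Ω → S) : ℕ → Ω → S
  | 0 => Y 0
  | k + 1 => fun ω => if stopped A Y k ω ∈ A then stopped A Y k ω else Y (k + 1) ω

theorem stopped_eq {A : Set S} {k : ℕ} {ω : Ω} (h : ∀ i < k, Y i ω ∉ A) :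
    stopped A Y k ω = Y k ω := by
  induction k with
  | zero => rfl
  | succ k ih =>
    have := ih fun i hi => h i (by omega)
    simp [stopped, this, h k (by omega)]

theorem stopped_eq_of_notMem {A : Set S} {k : ℕ} {ω : Ω} (h : stopped A Y k ω ∉ A) :
    stopped A Y k ω = Y k ω := by
  cases k with
  | zero => rfl
  | succ k =>
    by_cases h' : stopped A Y k ω ∈ A
    · simp [stopped, h'] at h
    · simp [stopped, h']

theorem stopped_eq_of_le {A : Set S} {k l : ℕ} {ω : Ω} (hkl : k ≤ l)
    (h : stopped A Y k ω ∈ A) : stopped A Y l ω = stopped A Y k ω := by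
  induction l, hkl using Nat.le_induction with
  | base => rfl
  | succ l _ ih => simp [stopped, ih, h]

theorem stopped_congr (A : Set S) {k : ℕ} {ω ω' : Ω} (h : ∀ i ≤ k, Y i ω = Y i ω') :
    stopped A Y k ω = stopped A Y k ω' := by
  induction k with
  | zero => exact h 0 le_rfl
  | succ k ih =>
    have := ih fun i hi => h i (by omega)
    simp only [stopped]
    rw [this, h (k + 1) le_rfl]

end Stopped

/-! ### Optional stopping for countable Markov chains -/

section Chain

variable {S : Type*} [Countable S] [MeasurableSpace S] [MeasurableSingletonClass S]
  {Ω : Type*} [MeasurableSpace Ω] {P : Measure Ω} {p : S → S → ℝ≥0∞} {x₀ : S} {Y : ℕ → Ω → S}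

/-- `Y` is a discrete-time Markov chain with transition weights `p`, started at `x₀`. -/
structure IsChain (p : S → S → ℝ≥0∞) (x₀ : S) (P : Measure Ω) (Y : ℕ → Ω → S) : Prop where
  measurable : ∀ k, Measurable (Y k)
  start : ∀ᵐ ω ∂P, Y 0 ω = x₀
  law : ∀ (n : ℕ) (y : ℕ → S), y 0 = x₀ →
    P {ω | ∀ k ≤ n, Y k ω = y k} = ∏ k ∈ Finset.range n, p (y k) (y (k + 1))

/-- The one-step Markov property, tested against functions `F` of the first `k + 1` states. -/
theorem IsChain.lintegral_step (h : IsChain p x₀ P Y) (k : ℕ) (F : Ω → ℝ≥0∞)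
    (hF : ∀ ω ω', (∀ i ≤ k, Y i ω = Y i ω') → F ω = F ω') (g : S → ℝ≥0∞) :
    ∫⁻ ω, F ω * g (Y (k + 1) ω) ∂P = ∫⁻ ω, F ω * ∑' z, p (Y k ω) z * g z ∂P := by
  classical
  set Z : Ω → (Fin (k + 1) → S) := fun ω i => Y i ω with hZ
  have hZm : Measurable Z := measurable_pi_lambda _ fun i => h.measurable i
  -- `F` factors through a countable discrete space, so its measurability is automatic.
  obtain ⟨F', rfl⟩ : ∃ F' : (Fin (k + 1) → S) → ℝ≥0∞, F = F' ∘ Z := by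
    rw [← Function.factorsThrough_iff]
    intro ω ω' hω
    exact hF ω ω' fun i hi => congrFun hω ⟨i, by omega⟩
  have hcyl : ∀ (u : Fin (k + 1) → S) (z : S),
      P {ω | Z ω = u ∧ Y (k + 1) ω = z} = P {ω | Z ω = u} * p (u (Fin.last k)) z := by
    intro u z
    by_cases hu : u 0 = x₀
    · set y : ℕ → S := fun i => if hi : i < k + 1 then u ⟨i, hi⟩ else z with hy
      have hyu : ∀ i (hi : i < k + 1), y i = u ⟨i, hi⟩ := fun i hi => dif_pos hi
      have hyz : y (k + 1) = z := by simp [hy]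
      have e1 : {ω | Z ω = u} = {ω | ∀ i ≤ k, Y i ω = y i} := by
        ext ω
        simp only [Set.mem_ofPred_eq, funext_iff, hZ]
        constructor
        · intro H i hi
          rw [hyu i (by omega)]
          exact H ⟨i, by omega⟩
        · intro H i
          rw [H i (by omega), hyu i i.2]
      have e2 : {ω | Z ω = u ∧ Y (k + 1) ω = z} = {ω | ∀ i ≤ k + 1, Y i ω = y i} := by
        ext ω
        have := Set.ext_iff.1 e1 ω
        simp only [Set.mem_ofPred_eq] at this ⊢
        rw [this]
        constructor
        · rintro ⟨H, H'⟩ i hi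
          rcases Nat.lt_or_ge i (k + 1) with hlt | hge
          · exact H i (by omega)
          · obtain rfl : i = k + 1 := by omega
            rw [H', hyz]
        · intro H
          exact ⟨fun i hi => H i (by omega), by rw [H _ le_rfl, hyz]⟩
      have h0 : y 0 = x₀ := by rw [hyu 0 (by omega), ← hu]; rfl
      rw [e1, e2, h.law _ _ h0, h.law _ _ h0, Finset.prod_range_succ, hyz, hyu k (by omega)]
      rfl
    · have hnull : P {ω | Z ω = u} = 0 := by
        refine measure_mono_null ?_ h.start
        intro ω hω hω'
        apply hu
        rw [← show Z ω = u from hω]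
        exact hω'
      rw [hnull, zero_mul]
      exact measure_mono_null (fun ω hω => hω.1) hnull
  have hpair : Measurable fun ω => (Z ω, Y (k + 1) ω) := hZm.prodMk (h.measurable _)
  have hL : ∫⁻ ω, (F' ∘ Z) ω * g (Y (k + 1) ω) ∂P
      = ∑' u, ∑' z, F' u * g z * (P {ω | Z ω = u} * p (u (Fin.last k)) z) := by
    have : ∫⁻ ω, (F' ∘ Z) ω * g (Y (k + 1) ω) ∂P
        = ∫⁻ w, F' w.1 * g w.2 ∂(P.map fun ω => (Z ω, Y (k + 1) ω)) := by
      rw [lintegral_map (measurable_of_countable _) hpair]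
      rfl
    rw [this, lintegral_countable', ENNReal.tsum_prod']
    refine tsum_congr fun u => tsum_congr fun z => ?_
    rw [← hcyl, Measure.map_apply hpair (measurableSet_singleton _)]
    congr 2
    ext ω
    simp [Prod.ext_iff]
  have hR : ∫⁻ ω, (F' ∘ Z) ω * ∑' z, p (Y k ω) z * g z ∂P
      = ∑' u, F' u * (∑' z, p (u (Fin.last k)) z * g z) * P {ω | Z ω = u} := by
    have : ∫⁻ ω, (F' ∘ Z) ω * ∑' z, p (Y k ω) z * g z ∂P
        = ∫⁻ u, F' u * (∑' z, p (u (Fin.last k)) z * g z) ∂(P.map Z) := by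
      rw [lintegral_map (measurable_of_countable _) hZm]
      rfl
    rw [this, lintegral_countable']
    refine tsum_congr fun u => ?_
    rw [Measure.map_apply hZm (measurableSet_singleton _)]
    rfl
  rw [hL, hR]
  refine tsum_congr fun u => ?_
  rw [mul_assoc, ← ENNReal.tsum_mul_right, ← ENNReal.tsum_mul_left]
  refine tsum_congr fun z => ?_
  ring

theorem measurable_stopped (A : Set S) (h : ∀ k, Measurable (Y k)) (k : ℕ) :
    Measurable (stopped A Y k) := by
  induction k with
  | zero => exact h 0
  | succ k ih => exact Measurable.ite (ih (Set.to_countable A).measurableSet) ih (h _)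

/-- The supermartingale inequality with drift `c` for the chain stopped upon entering `A`. -/
theorem IsChain.lintegral_stopped_succ_add_le (h : IsChain p x₀ P Y) (A : Set S)
    (g c : S → ℝ≥0∞) (hg : ∀ y ∉ A, ∑' z, p y z * g z + c y ≤ g y) (k : ℕ) :
    ∫⁻ ω, g (stopped A Y (k + 1) ω) ∂P + ∫⁻ ω, Aᶜ.indicator c (stopped A Y k ω) ∂P
      ≤ ∫⁻ ω, g (stopped A Y k ω) ∂P := by
  classical
  have hs : ∀ f : S → ℝ≥0∞, Measurable fun ω => f (stopped A Y k ω) := fun f =>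
    (measurable_of_countable f).comp (measurable_stopped A h.measurable k)
  set I : Ω → ℝ≥0∞ := fun ω => Aᶜ.indicator 1 (stopped A Y k ω) with hI
  have e1 : ∀ ω, g (stopped A Y (k + 1) ω)
      = A.indicator g (stopped A Y k ω) + I ω * g (Y (k + 1) ω) := by
    intro ω
    by_cases hω : stopped A Y k ω ∈ A <;> simp [stopped, hI, hω]
  have e2 : ∫⁻ ω, I ω * g (Y (k + 1) ω) ∂P = ∫⁻ ω, I ω * ∑' z, p (Y k ω) z * g z ∂P :=
    h.lintegral_step k I (fun ω ω' H => by simp only [hI, stopped_congr A H]) g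
  calc
    _ = ∫⁻ ω, A.indicator g (stopped A Y k ω) ∂P + ∫⁻ ω, I ω * ∑' z, p (Y k ω) z * g z ∂P
        + ∫⁻ ω, Aᶜ.indicator c (stopped A Y k ω) ∂P := by
      simp_rw [e1]
      rw [lintegral_add_left (hs _), e2]
    _ = ∫⁻ ω, (A.indicator g (stopped A Y k ω) + I ω * ∑' z, p (Y k ω) z * g z
        + Aᶜ.indicator c (stopped A Y k ω)) ∂P := by
      rw [lintegral_add_right _ (hs _), lintegral_add_left (hs _)]
    _ ≤ _ := by
      refine lintegral_mono fun ω => ?_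
      by_cases hω : stopped A Y k ω ∈ A
      · simp [hI, hω]
      · have := hg _ hω
        simpa [hI, hω, ← stopped_eq_of_notMem hω] using this

/-- A nonnegative superharmonic function bounds the integral of the stopped chain. -/
theorem IsChain.lintegral_stopped_le [IsProbabilityMeasure P] (h : IsChain p x₀ P Y) (A : Set S)
    (g : S → ℝ≥0∞) (hg : ∀ y ∉ A, ∑' z, p y z * g z ≤ g y) (k : ℕ) :
    ∫⁻ ω, g (stopped A Y k ω) ∂P ≤ g x₀ := by
  induction k with
  | zero =>
    rw [lintegral_congr_ae (g := fun _ => g x₀)]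
    · simp
    · filter_upwards [h.start] with ω hω
      simp [stopped, hω]
  | succ k ih =>
    refine le_trans ?_ ih
    have := h.lintegral_stopped_succ_add_le A g 0 (fun y hy => by simpa using hg y hy) k
    exact le_trans le_self_add this

/-- A Lyapunov function with drift at most `-1` off `A` forces the chain to enter `A`. -/
theorem IsChain.ae_exists_mem [IsProbabilityMeasure P] (h : IsChain p x₀ P Y) (A : Set S)
    (v : S → ℝ≥0∞) (hv : ∀ y ∉ A, ∑' z, p y z * v z + 1 ≤ v y) (hv₀ : v x₀ ≠ ∞) :
    ∀ᵐ ω ∂P, ∃ k, Y k ω ∈ A := by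
  have hs := measurable_stopped A h.measurable
  set B : Set Ω := {ω | ∀ k, Y k ω ∉ A} with hB
  -- On `B` the chain is never frozen, so each step costs at least `P B`; the finite budget `v x₀`
  -- then forces `P B = 0`.
  have key : ∀ k : ℕ, ∫⁻ ω, v (stopped A Y k ω) ∂P + k * P B ≤ v x₀ := by
    intro k
    induction k with
    | zero =>
      simpa using h.lintegral_stopped_le A v
        (fun y hy => le_trans le_self_add (hv y hy)) 0
    | succ k ih =>
      refine le_trans ?_ ih
      have h1 := h.lintegral_stopped_succ_add_le A v 1 (fun y hy => by simpa using hv y hy) k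
      have h2 : P B ≤ ∫⁻ ω, Aᶜ.indicator 1 (stopped A Y k ω) ∂P := by
        have : (fun ω => Aᶜ.indicator (1 : S → ℝ≥0∞) (stopped A Y k ω))
            = (stopped A Y k ⁻¹' Aᶜ).indicator 1 := by
          rfl
        rw [this, lintegral_indicator_one (hs k (Set.to_countable _).measurableSet)]
        refine measure_mono fun ω hω => ?_
        have := stopped_eq (A := A) (k := k) fun i _ => hω i
        simp only [Set.mem_preimage, this]
        exact hω k
      calc _ = (∫⁻ ω, v (stopped A Y (k + 1) ω) ∂P + P B) + k * P B := by push_cast; ring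
        _ ≤ _ := by gcongr; exact (add_le_add_right h2 _).trans h1
  have hzero : P B = 0 := by
    by_contra hne
    have h1 : ∀ k : ℕ, (k : ℝ≥0∞) ≤ v x₀ / P B := fun k =>
      (ENNReal.le_div_iff_mul_le (Or.inl hne) (Or.inl (measure_ne_top _ _))).2
        (le_trans le_add_self (key k))
    have h2 : v x₀ / P B ≠ ∞ := ENNReal.div_ne_top hv₀ hne
    obtain ⟨k, hk⟩ := ENNReal.exists_nat_gt h2
    exact absurd (h1 k) (not_le.2 hk)
  rw [ae_iff]
  simpa [hB] using hzero

/-- If `g` is superharmonic off `A` and at least `1` on `D ⊆ A`, then the chain enters `A` in `D`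
with probability at most `g x₀`. -/
theorem IsChain.measure_entry_le [IsProbabilityMeasure P] (h : IsChain p x₀ P Y) (A D : Set S)
    (hD : D ⊆ A) (g : S → ℝ≥0∞) (hg : ∀ y ∉ A, ∑' z, p y z * g z ≤ g y)
    (hgD : ∀ y ∈ D, 1 ≤ g y) :
    P {ω | ∃ k, (∀ i < k, Y i ω ∉ A) ∧ Y k ω ∈ D} ≤ g x₀ := by
  have hs := measurable_stopped A h.measurable
  have hsub : {ω | ∃ k, (∀ i < k, Y i ω ∉ A) ∧ Y k ω ∈ D} ⊆ ⋃ k, stopped A Y k ⁻¹' D := by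
    rintro ω ⟨k, hk, hkD⟩
    exact Set.mem_iUnion.2 ⟨k, by simpa [stopped_eq hk] using hkD⟩
  have hmono : Monotone fun k => stopped A Y k ⁻¹' D := by
    intro k l hkl ω hω
    simp only [Set.mem_preimage] at hω ⊢
    rwa [stopped_eq_of_le hkl (hD hω)]
  refine (measure_mono hsub).trans ?_
  rw [hmono.measure_iUnion]
  refine iSup_le fun k => ?_
  refine le_trans ?_ (h.lintegral_stopped_le A g hg k)
  rw [← lintegral_indicator_one (hs k (Set.to_countable _).measurableSet)]
  refine lintegral_mono fun ω => ?_
  by_cases hω : stopped A Y k ω ∈ D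
  · simpa [hω] using hgD _ hω
  · simp [hω]

end Chain

/-- There are countably many cylinders of length `n + 1`, and those not starting at `x₀` are null.
-/
theorem ae_of_forall_cylinder {S Ω : Type*} [Countable S] [MeasurableSpace Ω] {P : Measure Ω}
    {x₀ : S} {Y : ℕ → Ω → S} (h₀ : ∀ᵐ ω ∂P, Y 0 ω = x₀) (n : ℕ) {Q : Ω → Prop}
    (h : ∀ y : ℕ → S, y 0 = x₀ → P {ω | (∀ i ≤ n, Y i ω = y i) ∧ ¬ Q ω} = 0) :
    ∀ᵐ ω ∂P, Q ω := by
  have hall : ∀ u : Fin (n + 1) → S, ∀ᵐ ω ∂P, u 0 = x₀ → (∀ i : Fin (n + 1), Y i ω = u i) → Q ω := by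
    intro u
    by_cases hu : u 0 = x₀
    · have := h (fun i => if hi : i < n + 1 then u ⟨i, hi⟩ else x₀) (by simpa using hu)
      rw [ae_iff]
      refine measure_mono_null ?_ this
      intro ω hω
      simp only [Set.mem_ofPred_eq, Classical.not_imp] at hω ⊢
      refine ⟨fun i hi => ?_, hω.2.2⟩
      rw [dif_pos (by omega)]
      exact hω.2.1 ⟨i, by omega⟩
    · exact ae_of_all _ fun ω H => absurd H hu
  rw [← ae_all_iff] at hall
  filter_upwards [h₀, hall] with ω hω hω'
  exact hω' (fun i => Y i ω) hω fun i => rfl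

/-! ### From the jump process to its jump chain -/

section JumpProcess

variable {S : Type*} [Countable S] [MeasurableSpace S] [MeasurableSingletonClass S]
  {Ω : Type*} [MeasurableSpace Ω] {P : Measure Ω} {x₀ : S}

/-- The jump chain and the holding times of a Markov jump process without absorbing states. -/
theorem IsMarkovJumpProcess.exists_isChain [IsProbabilityMeasure P] {q : S → S → ℝ}
    {X : ℝ≥0 → Ω → S} (hX : IsMarkovJumpProcess q x₀ P X) (hrate : ∀ x, 0 < exitRate q x)
    (hnonneg : ∀ x y, 0 ≤ jumpProb q x y)
    (hsum : ∀ x, ∑' y, ENNReal.ofReal (jumpProb q x y) = 1) :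
    ∃ (Y : ℕ → Ω → S) (τ : ℕ → Ω → ℝ≥0∞),
      IsChain (fun x y => ENNReal.ofReal (jumpProb q x y)) x₀ P Y ∧
      (∀ᵐ ω ∂P, ∀ k, 0 < τ k ω) ∧ (∀ᵐ ω ∂P, ∀ k, τ k ω ≠ ∞) ∧
      (∀ᵐ ω ∂P, ∀ (k : ℕ) (t : ℝ≥0),
        (∑ i ∈ Finset.range k, τ i ω) ≤ t → (t : ℝ≥0∞) < ∑ i ∈ Finset.range (k + 1), τ i ω →
          X t ω = Y k ω) := by
  obtain ⟨Y, τ, hY, hτ, h0, hlaw, hpath⟩ := hX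
  set p : S → S → ℝ≥0∞ := fun x y => ENNReal.ofReal (jumpProb q x y) with hp
  have hcylm : ∀ (n : ℕ) (y : ℕ → S), MeasurableSet {ω | ∀ k ≤ n, Y k ω = y k} := by
    intro n y
    have : {ω | ∀ k ≤ n, Y k ω = y k} = ⋂ k ∈ Set.Iic n, Y k ⁻¹' {y k} := by
      ext ω; simp
    rw [this]
    exact MeasurableSet.biInter (Set.to_countable _) fun k _ => hY k (measurableSet_singleton _)
  have hlaw' : ∀ (n : ℕ) (y : ℕ → S) (t : ℕ → ℝ≥0), y 0 = x₀ →
      P {ω | ∀ k ≤ n, Y k ω = y k ∧ (t k : ℝ≥0∞) < τ k ω} =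
        (∏ k ∈ Finset.range n, p (y k) (y (k + 1))) *
          ENNReal.ofReal (∏ k ∈ Finset.range (n + 1), Real.exp (-(exitRate q (y k) * t k))) := by
    intro n y t hy
    rw [← ofReal_measureReal, hlaw n y t hy, ENNReal.ofReal_mul (Finset.prod_nonneg fun _ _ =>
      hnonneg _ _), ENNReal.ofReal_prod_of_nonneg fun _ _ => hnonneg _ _]
  -- At `t = 0` the law still carries the event that the holding times are positive; that this event
  -- is almost sure has to be deduced from the total mass being one.
  have hlaw0 : ∀ (n : ℕ) (y : ℕ → S), y 0 = x₀ →
      P {ω | ∀ k ≤ n, Y k ω = y k ∧ 0 < τ k ω} = ∏ k ∈ Finset.range n, p (y k) (y (k + 1)) := by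
    intro n y hy
    simpa using hlaw' n y 0 hy
  have hstep : ∀ n, (∀ᵐ ω ∂P, ∀ k ≤ n, 0 < τ k ω) → ∀ y : ℕ → S, y 0 = x₀ →
      P {ω | ∀ k ≤ n, Y k ω = y k} = ∏ k ∈ Finset.range n, p (y k) (y (k + 1)) := by
    intro n hn y hy
    rw [← hlaw0 n y hy]
    refine measure_congr ?_
    filter_upwards [hn] with ω hω
    refine propext ⟨fun H k hk => ⟨H k hk, hω k hk⟩, fun H k hk => (H k hk).1⟩
  have hpos : ∀ n, ∀ᵐ ω ∂P, ∀ k ≤ n, 0 < τ k ω := by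
    intro n
    induction n with
    | zero =>
      have h1 : P {ω | ∀ k ≤ 0, Y k ω = x₀ ∧ 0 < τ k ω} = 1 := by
        simpa using hlaw0 0 (fun _ => x₀) rfl
      have h2 : P {ω | 0 < τ 0 ω} = 1 := by
        refine le_antisymm prob_le_one (h1 ▸ measure_mono fun ω hω => (hω 0 le_rfl).2)
      have h3 : ∀ᵐ ω ∂P, 0 < τ 0 ω :=
        (prob_compl_eq_zero_iff (measurableSet_lt measurable_const (hτ 0))).2 h2
      filter_upwards [h3] with ω hω k hk
      obtain rfl : k = 0 := by omega
      exact hω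
    | succ n ih =>
      refine ae_of_forall_cylinder h0 n fun y hy => ?_
      set C : Set Ω := {ω | ∀ k ≤ n, Y k ω = y k} with hC
      set H : Set Ω := {ω | ∀ k ≤ n + 1, 0 < τ k ω} with hH
      have hHm : MeasurableSet H := by
        have : H = ⋂ k ∈ Set.Iic (n + 1), {ω | 0 < τ k ω} := by ext ω; simp [hH]
        rw [this]
        exact MeasurableSet.biInter (Set.to_countable _) fun k _ =>
          measurableSet_lt measurable_const (hτ k)
      -- Splitting `C ∩ H` according to the next state gives pieces of mass `P C * p (y n) z`, which
      -- add up to `P C`.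
      have hge : P C ≤ P (C ∩ H) := by
        let y' : S → ℕ → S := fun z i => if i ≤ n then y i else z
        have hz : ∀ z, P (C ∩ H ∩ Y (n + 1) ⁻¹' {z}) = P C * p (y n) z := by
          intro z
          have e : C ∩ H ∩ Y (n + 1) ⁻¹' {z}
              = {ω | ∀ k ≤ n + 1, Y k ω = y' z k ∧ 0 < τ k ω} := by
            ext ω
            simp only [hC, hH, Set.mem_inter_iff, Set.mem_ofPred_eq, Set.mem_preimage,
              Set.mem_singleton_iff]
            constructor
            · rintro ⟨⟨H1, H2⟩, H3⟩ k hk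
              refine ⟨?_, H2 k hk⟩
              by_cases hkn : k ≤ n
              · simp [y', hkn, H1 k hkn]
              · obtain rfl : k = n + 1 := by omega
                simpa [y'] using H3
            · intro H
              refine ⟨⟨fun k hk => ?_, fun k hk => (H k hk).2⟩, ?_⟩
              · simpa [y', hk] using (H k (by omega)).1
              · simpa [y'] using (H (n + 1) le_rfl).1
          rw [e, hlaw0 _ _ (by simpa [y'] using hy), Finset.prod_range_succ, hstep n ih y hy]
          congr 1
          · refine Finset.prod_congr rfl fun k hk => ?_
            have : k < n := Finset.mem_range.1 hk
            simp [y', this.le, Nat.succ_le_of_lt this]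
          · simp [y']
        calc P C = ∑' z, P C * p (y n) z := by rw [ENNReal.tsum_mul_left, hsum, mul_one]
          _ = ∑' z, P (C ∩ H ∩ Y (n + 1) ⁻¹' {z}) := tsum_congr fun z => (hz z).symm
          _ ≤ P (⋃ z, C ∩ H ∩ Y (n + 1) ⁻¹' {z}) := by
            refine tsum_meas_le_meas_iUnion_of_disjoint P (fun z => ((hcylm n y).inter hHm).inter
              (hY _ (measurableSet_singleton _))) ?_
            intro a b hab
            refine Set.disjoint_left.2 fun ω ha hb => hab ?_
            exact ha.2.symm.trans hb.2
          _ ≤ P (C ∩ H) := measure_mono (Set.iUnion_subset fun z => Set.inter_subset_left)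
      have hdiff : P (C \ H) = 0 := by
        have := measure_inter_add_sdiff C hHm (μ := P)
        have hfin : P (C ∩ H) ≠ ∞ := measure_ne_top _ _
        have h2 : P (C ∩ H) + P (C \ H) ≤ P (C ∩ H) + 0 := by rw [this, add_zero]; exact hge
        exact le_antisymm ((ENNReal.add_le_add_iff_left hfin).1 h2) zero_le
      exact hdiff
  have hfin : ∀ k, ∀ᵐ ω ∂P, τ k ω ≠ ∞ := by
    intro k
    refine ae_of_forall_cylinder h0 k fun y hy => ?_
    -- An infinite holding time exceeds every `T`, and the exponential tail tends to `0` because the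
    -- rate is positive.
    have hb : ∀ T : ℕ, P {ω | (∀ i ≤ k, Y i ω = y i) ∧ ¬ τ k ω ≠ ∞}
        ≤ (∏ i ∈ Finset.range k, p (y i) (y (i + 1))) *
          ENNReal.ofReal (Real.exp (-(exitRate q (y k) * T))) := by
      intro T
      have := hlaw' k y (fun i => if i = k then (T : ℝ≥0) else 0) hy
      have e : ∏ i ∈ Finset.range (k + 1),
          Real.exp (-(exitRate q (y i) * ((if i = k then (T : ℝ≥0) else 0 : ℝ≥0) : ℝ)))
          = Real.exp (-(exitRate q (y k) * T)) := by
        rw [Finset.prod_range_succ, Finset.prod_eq_one, one_mul]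
        · simp
        · intro i hi
          simp [(Finset.mem_range.1 hi).ne]
      rw [e] at this
      rw [← this]
      refine measure_mono_ae ?_
      filter_upwards [hpos k] with ω hω
      rintro ⟨H1, H2⟩ i hi
      refine ⟨H1 i hi, ?_⟩
      by_cases hik : i = k
      · subst hik
        simp [not_not.1 H2]
      · simpa [hik] using hω i hi
    have hlim : Tendsto (fun T : ℕ => (∏ i ∈ Finset.range k, p (y i) (y (i + 1))) *
        ENNReal.ofReal (Real.exp (-(exitRate q (y k) * T)))) atTop (𝓝 0) := by
      have h1 : Tendsto (fun T : ℕ => Real.exp (-(exitRate q (y k) * T))) atTop (𝓝 0) :=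
        Real.tendsto_exp_neg_atTop_nhds_zero.comp
          (tendsto_natCast_atTop_atTop.const_mul_atTop (hrate (y k)))
      have h2 := ENNReal.tendsto_ofReal h1
      have h3 := ENNReal.Tendsto.const_mul (a := ∏ i ∈ Finset.range k, p (y i) (y (i + 1))) h2
        (Or.inr (ENNReal.prod_ne_top fun _ _ => ENNReal.ofReal_ne_top))
      simpa using h3
    exact le_antisymm (ge_of_tendsto' hlim hb) zero_le
  refine ⟨Y, τ, ⟨hY, h0, fun n y hy => hstep n (hpos n) y hy⟩, ?_, ae_all_iff.2 hfin, hpath⟩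
  filter_upwards [ae_all_iff.2 hpos] with ω hω k
  exact hω k k le_rfl

end JumpProcess

/-- Along a path with positive finite holding times whose jump chain visits `{0} × ℕ` first at
step `N`, the cat reaches `0` and `X` is then in the state `y N`. -/
theorem apply_catHitZero_eq {Ω : Type*} {X : ℝ≥0 → Ω → ℕ × ℕ} {ω : Ω} {y : ℕ → ℕ × ℕ}
    {τ : ℕ → ℝ≥0∞} (hpos : ∀ k, 0 < τ k) (hfin : ∀ k, τ k ≠ ∞)
    (hX : ∀ (k : ℕ) (t : ℝ≥0), (∑ i ∈ Finset.range k, τ i) ≤ t →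
      (t : ℝ≥0∞) < ∑ i ∈ Finset.range (k + 1), τ i → X t ω = y k)
    {N : ℕ} (hN : (y N).1 = 0) (hlt : ∀ k < N, (y k).1 ≠ 0) :
    (∃ s : ℝ≥0, 0 < s ∧ (X s ω).1 = 0) ∧ X (catHitZero X ω) ω = y N := by
  lift τ to ℕ → ℝ≥0 using hfin
  simp only [ENNReal.coe_pos] at hpos
  have hX' : ∀ (k : ℕ) (t : ℝ≥0), (∑ i ∈ Finset.range k, τ i) ≤ t →
      t < ∑ i ∈ Finset.range (k + 1), τ i → X t ω = y k := fun k t h1 h2 =>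
    hX k t (by beta_reduce; exact_mod_cast h1) (by beta_reduce; exact_mod_cast h2)
  set σ : ℕ → ℝ≥0 := fun k => ∑ i ∈ Finset.range k, τ i with hσ
  have hσs : ∀ k, σ (k + 1) = σ k + τ k := fun k => Finset.sum_range_succ _ _
  have hσlt : ∀ k, σ k < σ (k + 1) := fun k => by rw [hσs]; exact lt_add_of_pos_right _ (hpos k)
  have hmem : ∀ t : ℝ≥0, 0 < t → σ N ≤ t → t < σ (N + 1) →
      t ∈ {s : ℝ≥0 | 0 < s ∧ (X s ω).1 = 0} := fun t h0 h1 h2 => ⟨h0, by rw [hX' N t h1 h2, hN]⟩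
  -- A time before `σ N` lies in a holding interval of index less than `N`, where the cat is not at
  -- `0`. Only finitely many jumps enter, so explosion plays no role.
  have hlow : ∀ t ∈ {s : ℝ≥0 | 0 < s ∧ (X s ω).1 = 0}, σ N ≤ t := by
    rintro t ⟨-, ht⟩
    by_contra! hlt'
    have hex : ∃ k, t < σ k := ⟨N, hlt'⟩
    classical
    obtain ⟨hk1, hk2⟩ := Nat.find_spec hex, fun m => Nat.find_min hex (m := m)
    have hkN : Nat.find hex ≤ N := Nat.find_min' hex hlt'
    rcases hk : Nat.find hex with _ | k
    · rw [hk] at hk1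
      simp [hσ] at hk1
    · rw [hk] at hk1 hk2 hkN
      have := hX' k t (not_lt.1 (hk2 k (by omega))) hk1
      rw [this] at ht
      exact hlt k (by omega) ht
  obtain ⟨s, hs1, hs2⟩ := exists_between (hσlt N)
  have hsmem := hmem s (lt_of_le_of_lt zero_le hs1) hs1.le hs2
  refine ⟨⟨s, hsmem⟩, ?_⟩
  have hT : catHitZero X ω = σ N := by
    refine le_antisymm ?_ (le_csInf ⟨s, hsmem⟩ hlow)
    -- The infimum is approached from the right: for `N = 0` it is `σ 0 = 0`, which is not itself an
    -- admissible time.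
    refine le_of_forall_gt_imp_ge_of_dense fun a ha => ?_
    obtain ⟨b, hb1, hb2⟩ := exists_between (lt_min ha (hσlt N))
    refine le_trans (csInf_le (OrderBot.bddBelow _) (hmem b (lt_of_le_of_lt zero_le hb1) hb1.le
      (hb2.trans_le (min_le_right _ _)))) (hb2.le.trans (min_le_left _ _))
  rw [hT]
  exact hX' N _ le_rfl (hσlt N)

/-! ### Rates of a general cat and mouse process -/

section Rates

variable {S : Type*}

/-- Nonnegative, summable off-diagonal rates without absorbing states. -/
structure IsNondegenerate (q : S → S → ℝ) : Prop where
  nonneg : ∀ x y, y ≠ x → 0 ≤ q x y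
  summable : ∀ x, Summable (open scoped Classical in fun y => if y = x then 0 else q x y)
  pos : ∀ x, 0 < exitRate q x

variable {q : S → S → ℝ}

open scoped Classical in
theorem IsNondegenerate.jumpProb_eq (h : IsNondegenerate q) (x y : S) :
    jumpProb q x y = if y = x then 0 else q x y / exitRate q x := by
  rw [jumpProb, if_neg (h.pos x).ne']

theorem IsNondegenerate.jumpProb_nonneg (h : IsNondegenerate q) (x y : S) :
    0 ≤ jumpProb q x y := by
  rw [h.jumpProb_eq]
  split_ifs with hxy
  · exact le_rfl
  · exact div_nonneg (h.nonneg x y hxy) (h.pos x).le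

theorem IsNondegenerate.hasSum_jumpProb (h : IsNondegenerate q) (x : S) :
    HasSum (jumpProb q x) 1 := by
  classical
  have h1 : HasSum (fun y => (if y = x then 0 else q x y) / exitRate q x) 1 := by
    have := (h.summable x).hasSum.div_const (exitRate q x)
    rwa [show (∑' y, if y = x then 0 else q x y) = exitRate q x from rfl,
      div_self (h.pos x).ne'] at this
  convert! h1 using 2 with y
  rw [h.jumpProb_eq]
  split_ifs <;> simp

theorem IsNondegenerate.tsum_ofReal_jumpProb (h : IsNondegenerate q) (x : S) :
    ∑' y, ENNReal.ofReal (jumpProb q x y) = 1 := by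
  rw [← ENNReal.ofReal_tsum_of_nonneg (h.jumpProb_nonneg x) (h.hasSum_jumpProb x).summable,
    (h.hasSum_jumpProb x).tsum_eq, ENNReal.ofReal_one]

-- From the diagonal the joint jump law is a product of probabilities, with no mass at `a` since
-- `p(x, x) = 0`; off it only the slice moved by the cat contributes. Both give the exit rate of the
-- cat.
open scoped Classical in
theorem IsNondegenerate.hasSum_catMouseRate (h : IsNondegenerate q) (a : S × S) :
    HasSum (fun b => if b = a then 0 else catMouseRate q a b) (exitRate q a.1) := by
  obtain ⟨x, y⟩ := a
  by_cases hxy : x = y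
  · subst hxy
    have h1 := ((h.hasSum_jumpProb x).mul (h.hasSum_jumpProb x)
      ((h.hasSum_jumpProb x).summable.mul_of_nonneg (h.hasSum_jumpProb x).summable
        (h.jumpProb_nonneg x) (h.jumpProb_nonneg x))).mul_left (exitRate q x)
    simp only [mul_one] at h1
    convert! h1 using 2 with b
    by_cases hb : b = (x, x)
    · simp [hb, h.jumpProb_eq]
    · simp [hb, catMouseRate]
  · have hinj : Function.Injective fun z : S => (z, y) := fun z z' hz => congrArg Prod.fst hz
    rw [← hinj.hasSum_iff]
    · convert! (h.summable x).hasSum using 2 with z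
      simp [catMouseRate, hxy]
    · rintro ⟨z, w⟩ hzw
      have hw : w ≠ y := fun e => hzw ⟨z, by simp [e]⟩
      simp [catMouseRate, hxy, hw]

theorem IsNondegenerate.exitRate_catMouseRate (h : IsNondegenerate q) (a : S × S) :
    exitRate (catMouseRate q) a = exitRate q a.1 := by
  rw [← (h.hasSum_catMouseRate a).tsum_eq, exitRate]
  congr!

theorem IsNondegenerate.catMouseRate (h : IsNondegenerate q) :
    IsNondegenerate (catMouseRate q) where
  nonneg a b hab := by
    rw [CatMouse.catMouseRate]
    split_ifs with h1 h2
    · exact mul_nonneg (h.pos _).le (mul_nonneg (h.jumpProb_nonneg _ _) (h.jumpProb_nonneg _ _))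
    · exact h.nonneg _ _ fun e => hab (Prod.ext e h2)
    · exact le_rfl
  summable a := by convert! (h.hasSum_catMouseRate a).summable
  pos a := by rw [h.exitRate_catMouseRate]; exact h.pos _

open scoped Classical in
theorem IsNondegenerate.jumpProb_catMouseRate (h : IsNondegenerate q) (a b : S × S) :
    jumpProb (CatMouse.catMouseRate q) a b =
      if a.1 = a.2 then jumpProb q a.1 b.1 * jumpProb q a.1 b.2
      else if b.2 = a.2 then jumpProb q a.1 b.1 else 0 := by
  rw [h.catMouseRate.jumpProb_eq, h.exitRate_catMouseRate, CatMouse.catMouseRate]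
  obtain ⟨x, y⟩ := a
  obtain ⟨z, w⟩ := b
  have := (h.pos x).ne'
  by_cases hxy : x = y
  · subst hxy
    by_cases hb : (z, w) = (x, x)
    · obtain ⟨rfl, rfl⟩ := Prod.mk.inj hb
      simp [h.jumpProb_eq]
    · simp only [hb, if_true, if_false]
      field_simp
  · by_cases hw : w = y
    · subst hw
      simp [hxy, h.jumpProb_eq]
    · simp [hxy, hw]

/-- Away from the diagonal only the cat moves. -/
theorem IsNondegenerate.tsum_catMouse_of_ne (h : IsNondegenerate q) {x y : S} (hxy : x ≠ y)
    (g : S × S → ℝ≥0∞) :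
    ∑' b, ENNReal.ofReal (jumpProb (CatMouse.catMouseRate q) (x, y) b) * g b =
      ∑' z, ENNReal.ofReal (jumpProb q x z) * g (z, y) := by
  have hinj : Function.Injective fun z : S => (z, y) := fun z z' hz => congrArg Prod.fst hz
  rw [← hinj.tsum_eq]
  · refine tsum_congr fun z => ?_
    rw [h.jumpProb_catMouseRate]
    simp [hxy]
  · rintro ⟨z, w⟩ hzw
    by_contra hw
    have hw : w ≠ y := fun e => hw ⟨z, by simp [e]⟩
    simp [h.jumpProb_catMouseRate, hxy, hw] at hzw

/-- On the diagonal the cat and the mouse move independently. -/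
theorem IsNondegenerate.tsum_catMouse_diag (h : IsNondegenerate q) (x : S)
    (g : S × S → ℝ≥0∞) :
    ∑' b, ENNReal.ofReal (jumpProb (CatMouse.catMouseRate q) (x, x) b) * g b =
      ∑' z, ENNReal.ofReal (jumpProb q x z) * ∑' w, ENNReal.ofReal (jumpProb q x w) * g (z, w) := by
  rw [ENNReal.tsum_prod']
  refine tsum_congr fun z => ?_
  rw [← ENNReal.tsum_mul_left]
  refine tsum_congr fun w => ?_
  rw [h.jumpProb_catMouseRate]
  simp [ENNReal.ofReal_mul (h.jumpProb_nonneg x z), mul_assoc]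

end Rates

/-! ### Rates of the `M/M/∞` queue -/

section Queue

variable {ρ : ℝ}

theorem hasSum_mmInftyRate (ρ : ℝ) (x : ℕ) :
    HasSum (open scoped Classical in fun y => if y = x then 0 else mmInftyRate ρ x y) (ρ + x) := by
  have h1 : HasSum (fun y => if y = x + 1 then ρ else 0) ρ := hasSum_ite_eq (x + 1) ρ
  have h2 : HasSum (fun y => if y + 1 = x then (x : ℝ) else 0) x := by
    rcases x with _ | k
    · simp
    · simpa using hasSum_ite_eq k ((k : ℝ) + 1)
  convert! h1.add h2 using 2 with y
  unfold mmInftyRate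
  by_cases e1 : y = x
  · simp [e1]
  · by_cases e2 : y = x + 1
    · simp [e2]
      omega
    · simp [e1, e2]

theorem exitRate_mmInftyRate (ρ : ℝ) (x : ℕ) : exitRate (mmInftyRate ρ) x = ρ + x := by
  rw [← (hasSum_mmInftyRate ρ x).tsum_eq, exitRate]
  congr!

theorem isNondegenerate_mmInftyRate (hρ : 0 < ρ) : IsNondegenerate (mmInftyRate ρ) where
  nonneg x y _ := by unfold mmInftyRate; split_ifs <;> positivity
  summable x := by convert! (hasSum_mmInftyRate ρ x).summable
  pos x := by rw [exitRate_mmInftyRate]; positivity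

theorem jumpProb_mmInftyRate (hρ : 0 < ρ) (x y : ℕ) :
    jumpProb (mmInftyRate ρ) x y =
      if y = x + 1 then ρ / (ρ + x) else if y + 1 = x then x / (ρ + x) else 0 := by
  rw [(isNondegenerate_mmInftyRate hρ).jumpProb_eq, exitRate_mmInftyRate, mmInftyRate]
  by_cases e1 : y = x
  · simp [e1]
  · by_cases e2 : y = x + 1
    · simp [e2]
    · by_cases e3 : y + 1 = x <;> simp [e1, e2, e3]

theorem tsum_jumpProb_mmInftyRate_mul (hρ : 0 < ρ) {x : ℕ} (hx : x ≠ 0) (g : ℕ → ℝ≥0∞) :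
    ∑' y, ENNReal.ofReal (jumpProb (mmInftyRate ρ) x y) * g y =
      ENNReal.ofReal (ρ / (ρ + x)) * g (x + 1) + ENNReal.ofReal (x / (ρ + x)) * g (x - 1) := by
  obtain ⟨k, rfl⟩ := Nat.exists_eq_succ_of_ne_zero hx
  rw [tsum_eq_sum (s := {k + 2, k})]
  · rw [Finset.sum_pair (by omega)]
    have : k ≠ k + 1 + 1 := by omega
    simp [jumpProb_mmInftyRate hρ, this]
  · intro y hy
    simp only [Finset.mem_insert, Finset.mem_singleton, not_or] at hy
    simp [jumpProb_mmInftyRate hρ, hy.1, hy.2]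

end Queue

/-! ### Lyapunov, scale and superharmonic functions -/

section Harmonic

variable {ρ : ℝ}

theorem tsum_jumpProb_mmInftyRate_mul_ofReal (hρ : 0 < ρ) {x : ℕ} (hx : x ≠ 0) {f : ℕ → ℝ}
    (hf : ∀ y, 0 ≤ f y) :
    ∑' y, ENNReal.ofReal (jumpProb (mmInftyRate ρ) x y) * ENNReal.ofReal (f y) =
      ENNReal.ofReal (ρ / (ρ + x) * f (x + 1) + x / (ρ + x) * f (x - 1)) := by
  have h1 := hf (x + 1)
  have h2 := hf (x - 1)
  rw [tsum_jumpProb_mmInftyRate_mul hρ hx, ENNReal.ofReal_add (by positivity) (by positivity),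
    ENNReal.ofReal_mul (by positivity), ENNReal.ofReal_mul (by positivity)]

/-- For increments `Δ i = v (i + 1) - v i` the condition at `x = k + 1` reads `ρ Δ (k + 1) + ρ + (k
+ 1) ≤ (k + 1) Δ k`. The constant part `2` of `Δ` suffices once `k ≥ 3ρ`; the geometric part `A * r
^ i` covers the finitely many smaller `k`. -/
theorem exists_lyapunov (hρ : 0 < ρ) :
    ∃ v : ℕ → ℝ, (∀ x, 0 ≤ v x) ∧
      ∀ x ≠ 0, ρ / (ρ + x) * v (x + 1) + x / (ρ + x) * v (x - 1) + 1 ≤ v x := by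
  set r : ℝ := 1 / (2 * (ρ + 1)) with hr
  have hr0 : 0 < r := by positivity
  have hr1 : r ≤ 1 := by
    rw [hr, div_le_one (by positivity)]
    linarith
  have hρr : ρ * r ≤ 1 / 2 := by
    rw [hr, mul_one_div, div_le_div_iff₀ (by positivity) (by norm_num)]
    linarith
  set K : ℕ := ⌈3 * ρ⌉₊
  set A : ℝ := 6 * ρ / r ^ K with hA
  have hA0 : 0 < A := by positivity
  refine ⟨fun x => ∑ i ∈ Finset.range x, (2 + A * r ^ i),
    fun x => Finset.sum_nonneg fun i _ => by positivity, fun x hx => ?_⟩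
  obtain ⟨k, rfl⟩ := Nat.exists_eq_succ_of_ne_zero hx
  simp only [Nat.succ_eq_add_one, Nat.add_sub_cancel, Finset.sum_range_succ, Nat.cast_add,
    Nat.cast_one]
  set s := ∑ i ∈ Finset.range k, (2 + A * r ^ i)
  have hk : 3 * ρ ≤ (k + 1) + A * r ^ k / 2 := by
    have h0 : 0 < A * r ^ k := by positivity
    rcases le_total K k with hKk | hkK
    · have h1 : 3 * ρ ≤ K := Nat.le_ceil _
      have h2 : (K : ℝ) ≤ k := by exact_mod_cast hKk
      linarith
    · have h1 : r ^ K ≤ r ^ k := pow_le_pow_of_le_one hr0.le hr1 hkK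
      have h2 : A * r ^ K = 6 * ρ := by rw [hA]; field_simp
      have h3 : A * r ^ K ≤ A * r ^ k := mul_le_mul_of_nonneg_left h1 hA0.le
      have : (0 : ℝ) ≤ k := by positivity
      linarith
  have h1 : ρ * (A * r ^ (k + 1)) ≤ A * r ^ k / 2 := by
    have := mul_le_mul_of_nonneg_right hρr (show 0 ≤ A * r ^ k by positivity)
    rw [pow_succ]
    linarith
  have h2 : 0 ≤ (k : ℝ) * (A * r ^ k) := by positivity
  have hpos : 0 < ρ + (k + 1 : ℝ) := by positivity
  clear_value A
  rw [div_mul_eq_mul_div, div_mul_eq_mul_div, ← add_div, div_add_one hpos.ne', div_le_iff₀ hpos]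
  linarith

/-- A scale function of the `M/M/∞` queue, vanishing at `0`. -/
noncomputable def scale (ρ : ℝ) (x : ℕ) : ℝ := ∑ i ∈ Finset.range x, (i.factorial : ℝ) / ρ ^ i

theorem scale_succ (ρ : ℝ) (x : ℕ) :
    scale ρ (x + 1) = scale ρ x + (x.factorial : ℝ) / ρ ^ x :=
  Finset.sum_range_succ _ _

theorem scale_nonneg (hρ : 0 < ρ) (x : ℕ) : 0 ≤ scale ρ x :=
  Finset.sum_nonneg fun i _ => by positivity

theorem scale_mono (hρ : 0 < ρ) : Monotone (scale ρ) :=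
  monotone_nat_of_le_succ fun x => by
    rw [scale_succ]
    have : 0 ≤ (x.factorial : ℝ) / ρ ^ x := by positivity
    linarith

theorem scale_pos (hρ : 0 < ρ) {x : ℕ} (hx : 0 < x) : 0 < scale ρ x := by
  have h1 : scale ρ 1 = 1 := by simp [scale]
  have := scale_mono hρ (show 1 ≤ x from hx)
  linarith

theorem scale_harmonic (hρ : 0 < ρ) {x : ℕ} (hx : x ≠ 0) :
    ρ / (ρ + x) * scale ρ (x + 1) + x / (ρ + x) * scale ρ (x - 1) = scale ρ x := by
  obtain ⟨k, rfl⟩ := Nat.exists_eq_succ_of_ne_zero hx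
  simp only [Nat.succ_eq_add_one, Nat.add_sub_cancel, scale_succ, Nat.factorial_succ,
    Nat.cast_mul, Nat.cast_add, Nat.cast_one, pow_succ]
  have hpos : 0 < ρ + (k + 1 : ℝ) := by positivity
  field_simp
  ring

/-- The ratio `scale ρ (n - 1) / scale ρ (n + 1)`, which is the probability that the queue started
at `n - 1` reaches `n + 1` before `0`. -/
noncomputable def upProb (ρ : ℝ) (n : ℕ) : ℝ := scale ρ (n - 1) / scale ρ (n + 1)

theorem upProb_nonneg (hρ : 0 < ρ) (n : ℕ) : 0 ≤ upProb ρ n :=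
  div_nonneg (scale_nonneg hρ _) (scale_nonneg hρ _)

theorem upProb_le_one (hρ : 0 < ρ) (n : ℕ) : upProb ρ n ≤ 1 :=
  div_le_one_of_le₀ (scale_mono hρ (by omega)) (scale_nonneg hρ _)

theorem tendsto_upProb (hρ : 0 < ρ) : Tendsto (upProb ρ) atTop (𝓝 0) := by
  set d : ℕ → ℝ := fun n => (n.factorial : ℝ) / ρ ^ n with hd
  have hd0 : ∀ n, 0 < d n := fun n => by positivity
  have hdS : ∀ n, d (n + 1) * ρ = (n + 1) * d n := fun n => by
    simp only [hd, Nat.factorial_succ, Nat.cast_mul, Nat.cast_add, Nat.cast_one, pow_succ]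
    field_simp
  -- The increments `d` of `scale` at least double once `n + 1 ≥ 2ρ`, so their sum is comparable
  -- with its next term.
  obtain ⟨C, hC0, hC⟩ : ∃ C : ℝ, 0 < C ∧ ∀ n, scale ρ n ≤ C * d n := by
    set K : ℕ := ⌈2 * ρ⌉₊
    obtain ⟨C, hC⟩ : ∃ C : ℝ, ∀ n ≤ K, scale ρ n / d n ≤ C := by
      obtain ⟨C, hC⟩ := ((Set.finite_Iic K).image fun n => scale ρ n / d n).bddAbove
      exact ⟨C, fun n hn => hC ⟨n, hn, rfl⟩⟩
    refine ⟨max C 1, by positivity, fun n => ?_⟩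
    induction n with
    | zero =>
      have h1 : (0 : ℝ) ≤ max C 1 := le_max_of_le_right zero_le_one
      rw [show scale ρ 0 = 0 by simp [scale]]
      exact mul_nonneg h1 (hd0 0).le
    | succ n ih =>
      rcases le_or_gt (n + 1) K with hn | hn
      · exact ((div_le_iff₀ (hd0 _)).1 (hC _ hn)).trans
          (mul_le_mul_of_nonneg_right (le_max_left _ _) (hd0 _).le)
      · have h1 : 2 * ρ ≤ n + 1 := by
          have h2 : 2 * ρ ≤ K := Nat.le_ceil _
          have h3 : (K : ℝ) ≤ (n : ℝ) + 1 := by exact_mod_cast hn.le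
          linarith
        have h2 : 2 * d n ≤ d (n + 1) := by
          have := mul_le_mul_of_nonneg_right h1 (hd0 n).le
          rw [← hdS n] at this
          nlinarith
        have h3 : (1 : ℝ) ≤ max C 1 := le_max_right _ _
        rw [scale_succ]
        calc scale ρ n + d n ≤ max C 1 * d n + max C 1 * d n := by
              have := mul_le_mul_of_nonneg_right h3 (hd0 n).le
              linarith
          _ = max C 1 * (2 * d n) := by ring
          _ ≤ _ := mul_le_mul_of_nonneg_left h2 (by positivity)
  have hb : ∀ n, upProb ρ (n + 1) ≤ C * ρ * (1 / ((n : ℝ) + 1)) := by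
    intro n
    have h1 : d (n + 1) ≤ scale ρ (n + 1 + 1) := by
      rw [scale_succ ρ (n + 1)]
      linarith [scale_nonneg hρ (n + 1)]
    have h2 : upProb ρ (n + 1) ≤ C * d n / d (n + 1) :=
      div_le_div₀ (mul_pos hC0 (hd0 n)).le (hC n) (hd0 _) h1
    refine h2.trans (le_of_eq ?_)
    rw [div_eq_iff (hd0 _).ne']
    have := hdS n
    field_simp
    linear_combination -this
  refine (tendsto_add_atTop_iff_nat 1).1 ?_
  refine squeeze_zero (fun n => upProb_nonneg hρ _) hb ?_
  simpa using (tendsto_one_div_add_atTop_nhds_zero_nat (𝕜 := ℝ)).const_mul (C * ρ)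

/-- The function on `ℕ × ℕ` equal to `G` on the diagonal and to `f` at the states `(0, y)`, `y ≠ 0`,
extended off the diagonal along the moves of the cat. -/
noncomputable def diagExtension (ρ : ℝ) (G f : ℕ → ℝ) (a : ℕ × ℕ) : ℝ :=
  if a.2 ≤ a.1 then G a.2
  else scale ρ a.1 / scale ρ a.2 * G a.2 + (1 - scale ρ a.1 / scale ρ a.2) * f a.2

variable {G f : ℕ → ℝ}

theorem diagExtension_nonneg (hρ : 0 < ρ) (hG : ∀ n, 0 ≤ G n) (hf : ∀ n, 0 ≤ f n) (a : ℕ × ℕ) :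
    0 ≤ diagExtension ρ G f a := by
  unfold diagExtension
  split_ifs with h
  · exact hG _
  · have h1 : 0 ≤ scale ρ a.1 / scale ρ a.2 := div_nonneg (scale_nonneg hρ _) (scale_nonneg hρ _)
    have h2 : scale ρ a.1 / scale ρ a.2 ≤ 1 :=
      div_le_one_of_le₀ (scale_mono hρ (by omega)) (scale_nonneg hρ _)
    exact add_nonneg (mul_nonneg h1 (hG _)) (mul_nonneg (by linarith) (hf _))

theorem diagExtension_of_le (hρ : 0 < ρ) {x y : ℕ} (hy : 0 < y) (hxy : x ≤ y) :
    diagExtension ρ G f (x, y) =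
      scale ρ x / scale ρ y * G y + (1 - scale ρ x / scale ρ y) * f y := by
  rcases hxy.lt_or_eq with h | rfl
  · simp [diagExtension, h]
  · simp [diagExtension, div_self (scale_pos hρ hy).ne']

/-- The inequality on the diagonal under which `diagExtension` is superharmonic. -/
def IsDiagSuperharmonic (ρ : ℝ) (G f : ℕ → ℝ) : Prop :=
  ∀ n : ℕ, n ≠ 0 → ρ / (ρ + n) * (ρ / (ρ + n) * G (n + 1) + n / (ρ + n) *
    (upProb ρ n * G (n + 1) + (1 - upProb ρ n) * f (n + 1))) + n / (ρ + n) * G (n - 1) ≤ G n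

/-- Off the diagonal equality holds: the extension is constant in the cat above the mouse and affine
in `scale` below it. On the diagonal both cat moves give `G (n - 1)` when the mouse goes down, which
leaves exactly `IsDiagSuperharmonic`. -/
theorem tsum_diagExtension_le (hρ : 0 < ρ) (hG : ∀ n, 0 ≤ G n) (hf : ∀ n, 0 ≤ f n)
    (hGf : IsDiagSuperharmonic ρ G f) {a : ℕ × ℕ} (ha : a.1 ≠ 0) :
    ∑' b, ENNReal.ofReal (jumpProb (catMouseRate (mmInftyRate ρ)) a b) *
      ENNReal.ofReal (diagExtension ρ G f b) ≤ ENNReal.ofReal (diagExtension ρ G f a) := by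
  have hq := isNondegenerate_mmInftyRate hρ
  have hD := diagExtension_nonneg hρ hG hf
  obtain ⟨x, y⟩ := a
  simp only at ha
  have hpos : 0 < ρ + (x : ℝ) := by positivity
  have hab : ρ / (ρ + x) + x / (ρ + x) = 1 := by rw [← add_div, div_self hpos.ne']
  by_cases hxy : x = y
  · subst hxy
    have hin : ∀ z, ∑' w, ENNReal.ofReal (jumpProb (mmInftyRate ρ) x w) *
        ENNReal.ofReal (diagExtension ρ G f (z, w)) =
        ENNReal.ofReal (ρ / (ρ + x) * diagExtension ρ G f (z, x + 1) +
          x / (ρ + x) * diagExtension ρ G f (z, x - 1)) := fun z =>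
      tsum_jumpProb_mmInftyRate_mul_ofReal hρ ha fun w => hD (z, w)
    rw [hq.tsum_catMouse_diag]
    simp_rw [hin]
    rw [tsum_jumpProb_mmInftyRate_mul_ofReal hρ ha fun z => by
      have := hD (z, x + 1); have := hD (z, x - 1); positivity]
    refine ENNReal.ofReal_le_ofReal ?_
    have e1 : diagExtension ρ G f (x + 1, x + 1) = G (x + 1) := by simp [diagExtension]
    have e2 : diagExtension ρ G f (x + 1, x - 1) = G (x - 1) := by
      simp only [diagExtension]; rw [if_pos (by omega)]
    have e3 : diagExtension ρ G f (x - 1, x - 1) = G (x - 1) := by simp [diagExtension]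
    have e4 : diagExtension ρ G f (x - 1, x + 1) =
        upProb ρ x * G (x + 1) + (1 - upProb ρ x) * f (x + 1) :=
      diagExtension_of_le hρ (by omega) (by omega)
    have e5 : diagExtension ρ G f (x, x) = G x := by simp [diagExtension]
    rw [e1, e2, e3, e4, e5]
    refine le_trans (le_of_eq ?_) (hGf x ha)
    linear_combination (x / (ρ + x) * G (x - 1)) * hab
  · rw [hq.tsum_catMouse_of_ne hxy, tsum_jumpProb_mmInftyRate_mul_ofReal hρ ha fun z => hD (z, y)]
    refine ENNReal.ofReal_le_ofReal (le_of_eq ?_)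
    rcases Nat.lt_or_gt_of_ne hxy with h | h
    · have hy : 0 < y := by omega
      rw [diagExtension_of_le hρ hy (show x + 1 ≤ y by omega),
        diagExtension_of_le hρ hy (show x - 1 ≤ y by omega), diagExtension_of_le hρ hy h.le,
        ← scale_harmonic hρ ha]
      linear_combination (f y) * hab
    · have e : ∀ z, y ≤ z → diagExtension ρ G f (z, y) = G y := fun z hz => by
        simp [diagExtension, hz]
      rw [e _ (by omega), e _ (by omega), e _ h.le]
      linear_combination (G y) * hab

variable {Ω : Type*} [MeasurableSpace Ω] {P : Measure Ω} [IsProbabilityMeasure P] {n : ℕ}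
  {Y : ℕ → Ω → ℕ × ℕ}

/-- The transition probabilities of the jump chain of the cat and mouse process. -/
noncomputable abbrev kernel (ρ : ℝ) (a b : ℕ × ℕ) : ℝ≥0∞ :=
  ENNReal.ofReal (jumpProb (catMouseRate (mmInftyRate ρ)) a b)

/-- The cat reaches `0` almost surely. -/
theorem IsChain.ae_exists_cat_eq_zero (hρ : 0 < ρ) {a : ℕ × ℕ} (h : IsChain (kernel ρ) a P Y) :
    ∀ᵐ ω ∂P, ∃ k, (Y k ω).1 = 0 := by
  obtain ⟨v, hv, hdrift⟩ := exists_lyapunov hρ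
  have hq := isNondegenerate_mmInftyRate hρ
  refine h.ae_exists_mem {a | a.1 = 0} (fun a => ENNReal.ofReal (v a.1)) ?_ ENNReal.ofReal_ne_top
  rintro ⟨x, y⟩ hx
  have hx : x ≠ 0 := hx
  have key : ∑' b, kernel ρ (x, y) b * ENNReal.ofReal (v b.1) =
      ∑' z, ENNReal.ofReal (jumpProb (mmInftyRate ρ) x z) * ENNReal.ofReal (v z) := by
    by_cases hxy : x = y
    · subst hxy
      rw [hq.tsum_catMouse_diag x fun b => ENNReal.ofReal (v b.1)]
      simp_rw [ENNReal.tsum_mul_right, hq.tsum_ofReal_jumpProb, one_mul]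
    · rw [hq.tsum_catMouse_of_ne hxy fun b => ENNReal.ofReal (v b.1)]
  have hv1 := hv (x + 1)
  have hv2 := hv (x - 1)
  rw [key, tsum_jumpProb_mmInftyRate_mul_ofReal hρ hx hv, ← ENNReal.ofReal_one,
    ← ENNReal.ofReal_add (by positivity) zero_le_one]
  exact ENNReal.ofReal_le_ofReal (hdrift x hx)

/-- Upper bound for the law of the mouse when the cat first reaches `0`. -/
theorem IsChain.measure_mouse_le (hρ : 0 < ρ) (h : IsChain (kernel ρ) (n, n) P Y)
    (hG : ∀ n, 0 ≤ G n) (hf : ∀ n, 0 ≤ f n) (hGf : IsDiagSuperharmonic ρ G f) (hGf₀ : f 0 ≤ G 0)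
    (D : Set ℕ) (hD : ∀ y ∈ D, 1 ≤ f y) :
    P {ω | ∃ k, (∀ i < k, (Y i ω).1 ≠ 0) ∧ (Y k ω).1 = 0 ∧ (Y k ω).2 ∈ D}
      ≤ ENNReal.ofReal (G n) := by
  have := h.measure_entry_le {a | a.1 = 0} {a | a.1 = 0 ∧ a.2 ∈ D} (fun a ha => ha.1)
    (fun a => ENNReal.ofReal (diagExtension ρ G f a))
    (fun a ha => tsum_diagExtension_le hρ hG hf hGf ha) ?_
  · simpa [diagExtension] using this
  · rintro ⟨x, y⟩ ⟨hx, hy⟩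
    obtain rfl : x = 0 := hx
    rw [← ENNReal.ofReal_one]
    refine ENNReal.ofReal_le_ofReal ((hD y hy).trans ?_)
    -- The state `(0, 0)` is both terminal and diagonal; the extension is `G 0` there, hence the
    -- need for `hGf₀`.
    rcases Nat.eq_zero_or_pos y with rfl | hy0
    · simpa [diagExtension] using hGf₀
    · rw [diagExtension_of_le hρ hy0 (Nat.zero_le y)]
      simp [scale]

end Harmonic

/-! ### Asymptotics of the products -/

section Products

/-- The product `∏_{1 ≤ j ≤ n} (j + s) / j`, of order `n ^ s`. -/
noncomputable def growth (s : ℝ) (n : ℕ) : ℝ :=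
  ∏ j ∈ Finset.range n, ((j : ℝ) + 1 + s) / ((j : ℝ) + 1)

theorem growth_succ (s : ℝ) (n : ℕ) :
    growth s (n + 1) = growth s n * (((n : ℝ) + 1 + s) / ((n : ℝ) + 1)) :=
  Finset.prod_range_succ _ _

theorem growth_pos {s : ℝ} (hs : 0 < s) (n : ℕ) : 0 < growth s n :=
  Finset.prod_pos fun j _ => by positivity

theorem growth_mono {s : ℝ} (hs : 0 < s) : Monotone (growth s) :=
  monotone_nat_of_le_succ fun n => by
    rw [growth_succ]
    refine le_mul_of_one_le_right (growth_pos hs n).le ?_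
    rw [one_le_div (by positivity)]
    linarith

/-- Euler's product: the quotient is exactly `(s * Real.GammaSeq s n)⁻¹`. -/
theorem tendsto_growth_div_rpow {s : ℝ} (hs : 0 < s) :
    Tendsto (fun n : ℕ => growth s n / (n : ℝ) ^ s) atTop (𝓝 (s * Real.Gamma s)⁻¹) := by
  have h1 : Tendsto (fun n => (s * Real.GammaSeq s n)⁻¹) atTop (𝓝 (s * Real.Gamma s)⁻¹) :=
    ((Real.GammaSeq_tendsto_Gamma s).const_mul s).inv₀
      (mul_pos hs (Real.Gamma_pos_of_pos hs)).ne'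
  refine h1.congr fun n => ?_
  have h2 : growth s n = (∏ j ∈ Finset.range n, (s + ((j + 1 : ℕ) : ℝ))) / n.factorial := by
    rw [growth, Finset.prod_div_distrib, ← Finset.prod_range_add_one_eq_factorial]
    push_cast
    congr 1
    exact Finset.prod_congr rfl fun j _ => by ring
  have h3 : 0 < ∏ j ∈ Finset.range n, (s + ((j + 1 : ℕ) : ℝ)) :=
    Finset.prod_pos fun j _ => by positivity
  rw [Real.GammaSeq, Finset.prod_range_succ', h2]
  simp only [Nat.cast_zero, add_zero]
  rw [mul_inv, inv_div]
  field_simp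

theorem tendsto_growth_ratio {s x : ℝ} (hs : 0 < s) (hx : 0 < x) {m : ℕ → ℕ}
    (hm : Tendsto (fun n => (m n : ℝ) / n) atTop (𝓝 x)) :
    Tendsto (fun n => growth s (m n) / growth s n) atTop (𝓝 (x ^ s)) := by
  have hc : 0 < (s * Real.Gamma s)⁻¹ := inv_pos.2 (mul_pos hs (Real.Gamma_pos_of_pos hs))
  have hm' : Tendsto m atTop atTop := by
    refine (tendsto_natCast_atTop_iff (R := ℝ)).1 ?_
    refine (hm.pos_mul_atTop hx tendsto_natCast_atTop_atTop).congr' ?_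
    filter_upwards [eventually_gt_atTop 0] with n hn
    exact div_mul_cancel₀ _ (by positivity)
  have h1 := ((tendsto_growth_div_rpow hs).comp hm').div (tendsto_growth_div_rpow hs) hc.ne'
  have h2 : Tendsto (fun n => ((m n : ℝ) / n) ^ s) atTop (𝓝 (x ^ s)) :=
    hm.rpow_const (Or.inl hx.ne')
  have h3 := h1.mul h2
  rw [div_self hc.ne', one_mul] at h3
  refine h3.congr' ?_
  filter_upwards [eventually_gt_atTop 0, hm'.eventually_gt_atTop 0] with n hn hmn
  have e1 : 0 < (n : ℝ) ^ s := Real.rpow_pos_of_pos (by positivity) _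
  have e2 : 0 < (m n : ℝ) ^ s := Real.rpow_pos_of_pos (by positivity) _
  have e3 := growth_pos hs n
  simp only [Function.comp_apply, Pi.div_apply]
  rw [Real.div_rpow (by positivity) (by positivity)]
  field_simp

theorem tendsto_floor_mul_div {x : ℝ} (hx : 0 ≤ x) :
    Tendsto (fun n : ℕ => ((⌊x * n⌋₊ : ℕ) : ℝ) / n) atTop (𝓝 x) :=
  (tendsto_nat_floor_mul_div_atTop hx).comp tendsto_natCast_atTop_atTop

theorem tendsto_floor_mul_atTop {x : ℝ} (hx : 0 < x) :
    Tendsto (fun n : ℕ => ⌊x * n⌋₊) atTop atTop :=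
  tendsto_nat_floor_atTop.comp (tendsto_natCast_atTop_atTop.const_mul_atTop hx)

/-- Squeezing distribution functions between ratios of growth products. -/
theorem tendsto_of_growth_bounds {ρ : ℝ} (hρ : 0 < ρ) {u : ℕ → ℕ → ℝ}
    (hupper : ∀ ε : ℝ, 0 < ε → ε < 1 → ∃ N, ∀ m ≥ N, ∀ n ≥ m, u n m ≤
      (growth (ρ + ρ * (1 - ε)) m / growth ρ m) / (growth (ρ + ρ * (1 - ε)) n / growth ρ n))
    (hlower : ∀ δ : ℝ, 0 < δ → δ < 1 → ∃ N, ∀ l ≥ N, ∀ n ≥ l,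
      growth ρ l / growth ρ n - δ ≤ u n (l + 1))
    {x : ℝ} (hx0 : 0 < x) (hx1 : x < 1) :
    Tendsto (fun n : ℕ => u n ⌊x * n⌋₊) atTop (𝓝 (x ^ ρ)) := by
  have hfl : ∀ n : ℕ, ⌊x * n⌋₊ ≤ n := fun n => by
    refine Nat.floor_le_of_le ?_
    have : (0 : ℝ) ≤ n := by positivity
    nlinarith
  have hatTop := tendsto_floor_mul_atTop hx0
  rw [tendsto_order]
  constructor
  · intro c hc
    obtain ⟨δ, hδ0, hδ⟩ : ∃ δ, 0 < δ ∧ δ < min 1 (x ^ ρ - c) :=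
      exists_between (lt_min one_pos (by linarith))
    have hδ1 : δ < 1 := hδ.trans_le (min_le_left _ _)
    have hδ2 : δ < x ^ ρ - c := hδ.trans_le (min_le_right _ _)
    obtain ⟨N, hN⟩ := hlower δ hδ0 hδ1
    have hm : Tendsto (fun n : ℕ => ((⌊x * n⌋₊ - 1 : ℕ) : ℝ) / n) atTop (𝓝 x) := by
      have h1 := (tendsto_floor_mul_div hx0.le).sub (tendsto_one_div_atTop_nhds_zero_nat (𝕜 := ℝ))
      rw [sub_zero] at h1
      refine h1.congr' ?_
      filter_upwards [hatTop.eventually_ge_atTop 1] with n hn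
      rw [Nat.cast_sub hn, Nat.cast_one, sub_div]
    have h2 := (tendsto_growth_ratio hρ hx0 hm).sub_const δ
    filter_upwards [h2.eventually_const_lt (show c < x ^ ρ - δ by linarith),
      hatTop.eventually_ge_atTop (N + 1)] with n hn hn'
    have h3 := hN (⌊x * n⌋₊ - 1) (by omega) n (by have := hfl n; omega)
    rw [Nat.sub_add_cancel (by omega)] at h3
    linarith
  · intro c hc
    -- For fixed `ε` the upper bound has limit `x ^ (ρ * (1 - ε))`; `ε` is chosen to bring it below
    -- `c`.
    have hcont : Tendsto (fun ε : ℝ => x ^ (ρ * (1 - ε))) (𝓝[>] 0) (𝓝 (x ^ ρ)) := by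
      have : Continuous fun ε : ℝ => x ^ (ρ * (1 - ε)) :=
        Real.continuous_const_rpow hx0.ne' |>.comp (by fun_prop)
      have h := this.tendsto 0
      simp only [sub_zero, mul_one] at h
      exact h.mono_left nhdsWithin_le_nhds
    obtain ⟨ε, hε, hε0, hε1⟩ := ((hcont.eventually_lt_const hc).and
      (Ioo_mem_nhdsGT (show (0 : ℝ) < 1 by norm_num))).exists
    obtain ⟨N, hN⟩ := hupper ε hε0 hε1
    have hs : 0 < ρ + ρ * (1 - ε) := by
      have : 0 < ρ * (1 - ε) := mul_pos hρ (by linarith)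
      linarith
    have hm := tendsto_floor_mul_div hx0.le
    have h1 := (tendsto_growth_ratio hs hx0 hm).div (tendsto_growth_ratio hρ hx0 hm)
      (Real.rpow_pos_of_pos hx0 ρ).ne'
    rw [← Real.rpow_sub hx0, add_sub_cancel_left] at h1
    filter_upwards [h1.eventually_lt_const hε, hatTop.eventually_ge_atTop N] with n hn hn'
    refine lt_of_le_of_lt (hN _ hn' n (hfl n)) (lt_of_eq_of_lt ?_ hn)
    simp only [Pi.div_apply]
    exact div_div_div_comm _ _ _ _

end Products

/-! ### The two barriers -/

section Barriers

variable {ρ : ℝ}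

theorem rate_add_rate (hρ : 0 < ρ) (n : ℕ) : ρ / (ρ + n) + n / (ρ + n) = 1 := by
  have : 0 < ρ + (n : ℝ) := by positivity
  rw [← add_div, div_self this.ne']

/-- Crude bound: every upward jump of the mouse is charged the maximal cost `1`. -/
theorem isDiagSuperharmonic_rhs_le (hρ : 0 < ρ) {G f : ℕ → ℝ} (hG : ∀ n, G n ≤ 1)
    (hf : ∀ n, f n ≤ 1) (n : ℕ) :
    ρ / (ρ + n) * (ρ / (ρ + n) * G (n + 1) + n / (ρ + n) *
      (upProb ρ n * G (n + 1) + (1 - upProb ρ n) * f (n + 1))) + n / (ρ + n) * G (n - 1)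
      ≤ ρ / (ρ + n) + n / (ρ + n) * G (n - 1) := by
  have ha : 0 ≤ ρ / (ρ + n) := by positivity
  have hb : 0 ≤ n / (ρ + n) := by positivity
  have hab := rate_add_rate hρ n
  have h0 := upProb_nonneg hρ n
  have h1 := upProb_le_one hρ n
  have e1 : upProb ρ n * G (n + 1) + (1 - upProb ρ n) * f (n + 1) ≤ 1 := by
    have := mul_le_mul_of_nonneg_left (hG (n + 1)) h0
    have := mul_le_mul_of_nonneg_left (hf (n + 1)) (sub_nonneg.2 h1)
    linarith
  have e2 := mul_le_mul_of_nonneg_left (hG (n + 1)) ha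
  have e3 := mul_le_mul_of_nonneg_left e1 hb
  have e4 := mul_le_mul_of_nonneg_left (show ρ / (ρ + n) * G (n + 1) + n / (ρ + n) *
    (upProb ρ n * G (n + 1) + (1 - upProb ρ n) * f (n + 1)) ≤ 1 by linarith) ha
  linarith

open scoped Classical in
/-- The barrier that controls the probability that the mouse ends above level `l + 1`. -/
theorem isDiagSuperharmonic_above (hρ : 0 < ρ) {δ : ℝ} (hδ0 : 0 < δ) (hδ1 : δ < 1) {l : ℕ}
    (h1 : ρ / (ρ + l) + upProb ρ l ≤ 1 / 2) (h2 : ρ / (ρ + (l + 1 : ℕ)) ≤ δ) :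
    IsDiagSuperharmonic ρ (fun k => min 1 (δ + 1 - growth ρ l / growth ρ (max k l)))
      (fun k => if l + 1 < k then 1 else 0) := by
  intro n hn
  set G : ℕ → ℝ := fun k => min 1 (δ + 1 - growth ρ l / growth ρ (max k l)) with hG
  set f : ℕ → ℝ := fun k => if l + 1 < k then 1 else 0 with hf
  have hG1 : ∀ k, G k ≤ 1 := fun k => min_le_left _ _
  have hf1 : ∀ k, f k ≤ 1 := fun k => by simp only [hf]; split_ifs <;> norm_num
  have hpos := growth_pos hρ
  have ha : 0 ≤ ρ / (ρ + n) := by positivity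
  have hb : 0 ≤ n / (ρ + n) := by positivity
  have hab := rate_add_rate hρ n
  have hle : ∀ k ≤ l, G k = δ := fun k hk => by
    simp only [hG, max_eq_right hk, div_self (hpos l).ne']
    rw [add_sub_cancel_right, min_eq_right hδ1.le]
  rcases Nat.lt_or_ge l n with hln | hln
  -- The ratio `growth ρ l / growth ρ n` is the probability of going straight down from `n` to `l`,
  -- so it satisfies the one-step recursion `e2`.
  · refine (isDiagSuperharmonic_rhs_le hρ hG1 hf1 n).trans (le_min ?_ ?_)
    · have := mul_le_mul_of_nonneg_left (hG1 (n - 1)) hb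
      linarith
    · obtain ⟨k, rfl⟩ := Nat.exists_eq_succ_of_ne_zero hn
      have hk : l ≤ k := by omega
      have e1 : G k ≤ δ + 1 - growth ρ l / growth ρ k := by
        simp [hG, max_eq_left hk]
      have e2 : growth ρ l / growth ρ (k + 1)
          = ((k + 1 : ℕ) / (ρ + (k + 1 : ℕ)) : ℝ) * (growth ρ l / growth ρ k) := by
        rw [growth_succ]
        have := hpos k
        push_cast
        field_simp
        ring
      simp only [Nat.succ_eq_add_one, Nat.add_sub_cancel] at *
      rw [max_eq_left (by omega : l ≤ k + 1), e2]
      have e3 := mul_le_mul_of_nonneg_left e1 hb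
      have e4 : ((k + 1 : ℕ) / (ρ + (k + 1 : ℕ)) : ℝ) * δ ≤ δ := by
        refine mul_le_of_le_one_left hδ0.le ?_
        linarith
      linarith
  -- The threshold is `l + 1`, so that a mouse left behind after an upward jump from `l` costs
  -- nothing.
  · have hfn : f (n + 1) = 0 := if_neg (by omega)
    have hGn : G n = δ := hle n hln
    have hGn1 : G (n - 1) = δ := hle _ (by omega)
    have hup0 := upProb_nonneg hρ n
    have hup1 := upProb_le_one hρ n
    have key : (ρ / (ρ + n) + n / (ρ + n) * upProb ρ n) * G (n + 1) ≤ δ := by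
      have hc0 : 0 ≤ ρ / (ρ + n) + n / (ρ + n) * upProb ρ n := by positivity
      rcases hln.lt_or_eq with hlt | rfl
      · rw [hle (n + 1) hlt]
        refine mul_le_of_le_one_left hδ0.le ?_
        have := mul_le_mul_of_nonneg_left hup1 hb
        linarith
      -- At `n = l` the slack `δ` is needed: `G` may double at the next level, and the conditional
      -- probability, at most `1 / 2`, of meeting again there compensates.
      · have e1 : G (n + 1) ≤ 2 * δ := by
          refine (min_le_right _ _).trans ?_
          rw [max_eq_left (by omega : n ≤ n + 1), growth_succ]
          have := hpos n
          have e : growth ρ n / (growth ρ n * (((n : ℝ) + 1 + ρ) / ((n : ℝ) + 1)))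
              = 1 - ρ / (ρ + (n + 1 : ℕ)) := by
            push_cast
            field_simp
            ring
          rw [e]
          linarith
        have e2 : ρ / (ρ + n) + n / (ρ + n) * upProb ρ n ≤ 1 / 2 := by
          have : n / (ρ + n) * upProb ρ n ≤ upProb ρ n :=
            mul_le_of_le_one_left hup0 (by linarith)
          linarith
        calc _ ≤ (ρ / (ρ + n) + n / (ρ + n) * upProb ρ n) * (2 * δ) :=
              mul_le_mul_of_nonneg_left e1 hc0
          _ ≤ 1 / 2 * (2 * δ) := mul_le_mul_of_nonneg_right e2 (by linarith)
          _ = δ := by ring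
    change _ ≤ G n
    rw [hfn, hGn, hGn1]
    have e5 := mul_le_mul_of_nonneg_left key ha
    have e6 : δ = ρ / (ρ + n) * δ + n / (ρ + n) * δ := by rw [← add_mul, hab, one_mul]
    linarith

open scoped Classical in
/-- The barrier that controls the probability that the mouse ends at or below level `m`. -/
theorem isDiagSuperharmonic_below (hρ : 0 < ρ) {ε : ℝ} (hε1 : ε < 1) {m : ℕ}
    (h : ∀ k > m, upProb ρ k ≤ ε) {W : ℕ → ℝ} (hW0 : ∀ k, 0 < W k)
    (hW : ∀ k, W (k + 1) = W k * (1 + ρ / (ρ + (k + 1 : ℕ)) * (1 - ε))) :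
    IsDiagSuperharmonic ρ (fun k => W m / W (max k m)) (fun k => if k ≤ m then 1 else 0) := by
  intro n hn
  set G : ℕ → ℝ := fun k => W m / W (max k m) with hG
  set f : ℕ → ℝ := fun k => if k ≤ m then 1 else 0 with hf
  have hWm : Monotone W := monotone_nat_of_le_succ fun k => by
    rw [hW]
    refine le_mul_of_one_le_right (hW0 k).le ?_
    have : 0 ≤ ρ / (ρ + (k + 1 : ℕ)) * (1 - ε) := mul_nonneg (by positivity) (by linarith)
    linarith
  have hG1 : ∀ k, G k ≤ 1 := fun k => div_le_one_of_le₀ (hWm (le_max_right _ _)) (hW0 _).le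
  have hG0 : ∀ k, 0 ≤ G k := fun k => div_nonneg (hW0 _).le (hW0 _).le
  have hf1 : ∀ k, f k ≤ 1 := fun k => by simp only [hf]; split_ifs <;> norm_num
  have ha : 0 ≤ ρ / (ρ + n) := by positivity
  have hb : 0 ≤ n / (ρ + n) := by positivity
  have hab := rate_add_rate hρ n
  change _ ≤ G n
  rcases Nat.lt_or_ge m n with hmn | hmn
  · have hfn : f (n + 1) = 0 := if_neg (by omega)
    have e1 : G (n + 1) ≤ G n := div_le_div_of_nonneg_left (hW0 m).le (hW0 _)
      (hWm (max_le_max (Nat.le_succ n) le_rfl))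
    have e2 : G (n - 1) = G n * (1 + ρ / (ρ + n) * (1 - ε)) := by
      obtain ⟨k, rfl⟩ := Nat.exists_eq_succ_of_ne_zero hn
      simp only [Nat.succ_eq_add_one, Nat.add_sub_cancel, hG]
      rw [max_eq_left (by omega : m ≤ k + 1), max_eq_left (by omega : m ≤ k), hW k]
      have := hW0 k
      have : 0 < 1 + ρ / (ρ + (k + 1 : ℕ)) * (1 - ε) := by
        have : 0 ≤ ρ / (ρ + (k + 1 : ℕ)) * (1 - ε) := mul_nonneg (by positivity) (by linarith)
        linarith
      rw [div_mul_eq_mul_div, mul_div_mul_right _ _ this.ne']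
    have hup0 := upProb_nonneg hρ n
    have hc0 : 0 ≤ ρ / (ρ + n) * (ρ / (ρ + n) + n / (ρ + n) * upProb ρ n) := by positivity
    have e3 := mul_le_mul_of_nonneg_left e1 hc0
    have e4 : 0 ≤ ρ / (ρ + n) * (n / (ρ + n)) * (ε - upProb ρ n) * G n :=
      mul_nonneg (mul_nonneg (mul_nonneg ha hb) (sub_nonneg.2 (h n hmn))) (hG0 n)
    rw [hfn, e2]
    -- With `a = ρ / (ρ + n)`, `b = n / (ρ + n)` and `u = upProb ρ n`, the coefficient of `G n` is
    -- `a (a + b u) + b (1 + a (1 - ε)) = 1 + a b (u - ε)`; the recursion for `W` is chosen for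
    -- this.
    linear_combination e3 + e4 + G n * (ρ / (ρ + n) + 1) * hab
  · have hGn : G n = 1 := by simp only [hG]; rw [max_eq_right hmn, div_self (hW0 m).ne']
    rw [hGn]
    refine (isDiagSuperharmonic_rhs_le hρ hG1 hf1 n).trans ?_
    have := mul_le_mul_of_nonneg_left (hG1 (n - 1)) hb
    linarith

end Barriers

/-! ### Convergence in distribution and the limit law -/

theorem measureReal_mem_Ioc {α : Type*} [MeasurableSpace α] (Q : Measure α) [IsFiniteMeasure Q]
    {f : α → ℝ} (hf : Measurable f) {a b : ℝ} (hab : a ≤ b) :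
    Q.real {ω | f ω ∈ Set.Ioc a b} = Q.real {ω | f ω ≤ b} - Q.real {ω | f ω ≤ a} := by
  have hsub : {ω | f ω ≤ a} ⊆ {ω | f ω ≤ b} := fun ω hω => le_trans hω hab
  rw [← measureReal_sdiff hsub (measurableSet_le hf measurable_const)]
  congr 1
  ext ω
  simp [and_comm]

/-- Convergence of the distribution functions at every point implies convergence in
distribution. -/
theorem tendstoInDistribution_of_forall_tendsto_cdf {Ω : ℕ → Type*} [∀ n, MeasurableSpace (Ω n)]
    {P : (n : ℕ) → Measure (Ω n)} [∀ n, IsProbabilityMeasure (P n)] {Ω' : Type*}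
    [MeasurableSpace Ω'] {P' : Measure Ω'} [IsProbabilityMeasure P'] {U : (n : ℕ) → Ω n → ℝ}
    {F : Ω' → ℝ} (hU : ∀ n, Measurable (U n)) (hF : Measurable F)
    (h : ∀ x, Tendsto (fun n => (P n).real {ω | U n ω ≤ x}) atTop (𝓝 (P'.real {ω | F ω ≤ x}))) :
    TendstoInDistribution U atTop F P P' where
  forall_aemeasurable n := (hU n).aemeasurable
  aemeasurable_limit := hF.aemeasurable
  tendsto := by
    refine (isPiSystem_Ioc (id : ℝ → ℝ) id).tendsto_probabilityMeasure_of_tendsto_of_mem ?_ ?_ ?_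
    · rintro s ⟨a, b, -, rfl⟩
      exact measurableSet_Ioc
    · intro u hu x hx
      obtain ⟨δ, hδ, hδu⟩ := Metric.isOpen_iff.1 hu x hx
      refine ⟨Set.Ioc (x - δ / 2) (x + δ / 2), ⟨_, _, by simp only [id]; linarith, rfl⟩,
        Ioc_mem_nhds (by linarith) (by linarith), fun y hy => hδu ?_⟩
      rw [Metric.mem_ball, Real.dist_eq, abs_lt]
      constructor <;> linarith [hy.1, hy.2]
    · rintro s ⟨a, b, hab, rfl⟩
      simp only [id] at hab ⊢
      rw [← NNReal.tendsto_coe]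
      have key := (h b).sub (h a)
      rw [← measureReal_mem_Ioc P' hF hab.le] at key
      have e : ∀ n, (P n).real {ω | U n ω ≤ b} - (P n).real {ω | U n ω ≤ a} =
          ((P n).map (U n)).real (Set.Ioc a b) := fun n => by
        rw [map_measureReal_apply (hU n) measurableSet_Ioc, ← measureReal_mem_Ioc (P n) (hU n) hab.le]
        rfl
      simp_rw [e] at key
      rw [show P'.real {ω | F ω ∈ Set.Ioc a b} = (P'.map F).real (Set.Ioc a b) from
        (map_measureReal_apply hF measurableSet_Ioc).symm] at key
      exact key

/-- The limit `F` is realised as `U ^ (1 / ρ)` with `U` uniform on the unit interval. -/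
theorem volume_real_rpow_le {ρ : ℝ} (hρ : 0 < ρ) {x : ℝ} (hx : x ∈ Set.Icc (0 : ℝ) 1) :
    (volume : Measure unitInterval).real {u | (u : ℝ) ^ (1 / ρ) ≤ x} = x ^ ρ := by
  have hmem : x ^ ρ ∈ unitInterval :=
    ⟨Real.rpow_nonneg hx.1 _, Real.rpow_le_one hx.1 hx.2 hρ.le⟩
  have : {u : unitInterval | (u : ℝ) ^ (1 / ρ) ≤ x} = Set.Iic ⟨x ^ ρ, hmem⟩ := by
    ext u
    rw [Set.mem_ofPred_eq, Set.mem_Iic, ← Subtype.coe_le_coe, one_div,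
      Real.rpow_inv_le_iff_of_pos u.2.1 hx.1 hρ]
  rw [this, Measure.real, unitInterval.volume_Iic, ENNReal.toReal_ofReal hmem.1]

/-! ### The final position of the mouse -/

section Entry

variable {S : Type*} [Countable S] [MeasurableSpace S] [MeasurableSingletonClass S]
  {Ω : Type*} [MeasurableSpace Ω]

/-- No measurability of `X` is assumed, so the terminal state is read off the jump chain instead. On
paths avoiding `A` the value is the junk `Y 0`. -/
theorem exists_measurable_entry {Y : ℕ → Ω → S} (hY : ∀ k, Measurable (Y k)) (A : Set S) :
    ∃ V : Ω → S, Measurable V ∧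
      ∀ ω, (∃ k, Y k ω ∈ A) → ∃ k, (∀ i < k, Y i ω ∉ A) ∧ Y k ω ∈ A ∧ V ω = Y k ω := by
  classical
  have hA : ∀ k, MeasurableSet {ω | Y k ω ∈ A} := fun k =>
    hY k (Set.to_countable A).measurableSet
  have hex : ∀ ω, ∃ k, Y k ω ∈ A ∨ ∀ j, Y j ω ∉ A := fun ω => by
    by_cases h : ∃ k, Y k ω ∈ A
    · exact h.imp fun k hk => Or.inl hk
    · exact ⟨0, Or.inr fun j hj => h ⟨j, hj⟩⟩
  have hm : ∀ k, MeasurableSet {ω | Y k ω ∈ A ∨ ∀ j, Y j ω ∉ A} := fun k => by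
    have : {ω | Y k ω ∈ A ∨ ∀ j, Y j ω ∉ A} = {ω | Y k ω ∈ A} ∪ ⋂ j, {ω | Y j ω ∈ A}ᶜ := by
      ext ω; simp
    rw [this]
    exact (hA k).union (MeasurableSet.iInter fun j => (hA j).compl)
  refine ⟨fun ω => Y (Nat.find (hex ω)) ω, Measurable.find hY hm hex, fun ω hω => ?_⟩
  refine ⟨Nat.find (hex ω), fun i hi hiA => Nat.find_min (hex ω) hi (Or.inl hiA), ?_, rfl⟩
  rcases Nat.find_spec (hex ω) with h | h
  · exact h
  · exact absurd hω (not_exists.2 h)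

end Entry

/-- A measurable version `V` of the position of the mouse when the cat first hits `0`, with the
bounds on its law provided by superharmonic functions. -/
theorem IsMarkovJumpProcess.exists_mouse {ρ : ℝ} (hρ : 0 < ρ) {Ω : Type*} [MeasurableSpace Ω]
    {P : Measure Ω} [IsProbabilityMeasure P] {X : ℝ≥0 → Ω → ℕ × ℕ} {n : ℕ}
    (hX : IsMarkovJumpProcess (catMouseRate (mmInftyRate ρ)) (n, n) P X) :
    ∃ V : Ω → ℕ, Measurable V ∧ (∀ᵐ ω ∂P, ∃ s : ℝ≥0, 0 < s ∧ (X s ω).1 = 0) ∧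
      (∀ᵐ ω ∂P, V ω = (X (catHitZero X ω) ω).2) ∧
      ∀ G f : ℕ → ℝ, (∀ k, 0 ≤ G k) → (∀ k, 0 ≤ f k) → IsDiagSuperharmonic ρ G f → f 0 ≤ G 0 →
        ∀ D : Set ℕ, (∀ y ∈ D, 1 ≤ f y) → P.real {ω | V ω ∈ D} ≤ G n := by
  have hq := (isNondegenerate_mmInftyRate hρ).catMouseRate
  obtain ⟨Y, τ, hY, hpos, hfin, hpath⟩ :=
    hX.exists_isChain hq.pos hq.jumpProb_nonneg hq.tsum_ofReal_jumpProb
  obtain ⟨V, hV, hVY⟩ := exists_measurable_entry hY.measurable {a : ℕ × ℕ | a.1 = 0}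
  have hex : ∀ᵐ ω ∂P, ∃ k, (Y k ω).1 = 0 := hY.ae_exists_cat_eq_zero hρ
  have hae : ∀ᵐ ω ∂P, (∃ s : ℝ≥0, 0 < s ∧ (X s ω).1 = 0) ∧ X (catHitZero X ω) ω = V ω := by
    filter_upwards [hpos, hfin, hpath, hex] with ω h1 h2 h3 h4
    obtain ⟨N, hlt, hN, hVN⟩ := hVY ω h4
    rw [hVN]
    exact apply_catHitZero_eq (y := fun k => Y k ω) h1 h2 h3 hN hlt
  refine ⟨fun ω => (V ω).2, measurable_snd.comp hV, hae.mono fun ω h => h.1,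
    hae.mono fun ω h => by rw [h.2], fun G f hG hf hGf hGf₀ D hD => ?_⟩
  refine ENNReal.toReal_le_of_le_ofReal (hG n) ?_
  refine le_trans (measure_mono_ae ?_) (hY.measure_mouse_le hρ hG hf hGf hGf₀ D hD)
  filter_upwards [hex] with ω h4 hω
  obtain ⟨N, hlt, hN, hVN⟩ := hVY ω h4
  exact ⟨N, hlt, hN, by rw [← hVN]; exact hω⟩

theorem tendsto_real_mouse_le {ρ : ℝ} (hρ : 0 < ρ) {Ω : ℕ → Type*} [∀ n, MeasurableSpace (Ω n)]
    {P : (n : ℕ) → Measure (Ω n)} [∀ n, IsProbabilityMeasure (P n)] {V : (n : ℕ) → Ω n → ℕ}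
    (hV : ∀ n, Measurable (V n))
    (hbound : ∀ n, ∀ G f : ℕ → ℝ, (∀ k, 0 ≤ G k) → (∀ k, 0 ≤ f k) → IsDiagSuperharmonic ρ G f →
      f 0 ≤ G 0 → ∀ D : Set ℕ, (∀ y ∈ D, 1 ≤ f y) → (P n).real {ω | V n ω ∈ D} ≤ G n)
    {x : ℝ} (hx0 : 0 < x) (hx1 : x < 1) :
    Tendsto (fun n => (P n).real {ω | V n ω ≤ ⌊x * n⌋₊}) atTop (𝓝 (x ^ ρ)) := by
  classical
  have hup := tendsto_upProb hρ
  have hrate : Tendsto (fun l : ℕ => ρ / (ρ + l)) atTop (𝓝 0) :=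
    tendsto_const_nhds.div_atTop (tendsto_atTop_add_const_left _ ρ tendsto_natCast_atTop_atTop)
  refine tendsto_of_growth_bounds hρ (u := fun n m => (P n).real {ω | V n ω ≤ m}) ?_ ?_ hx0 hx1
  · intro ε hε0 hε1
    have hs : 0 < ρ + ρ * (1 - ε) := by
      have : 0 < ρ * (1 - ε) := mul_pos hρ (by linarith)
      linarith
    obtain ⟨N, hN⟩ := eventually_atTop.1 (hup.eventually_le_const hε0)
    refine ⟨N, fun m hm n hn => ?_⟩
    -- This quotient, of order `k ^ (ρ * (1 - ε))`, solves the recursion required of `W` explicitly.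
    have hW0 : ∀ k, 0 < growth (ρ + ρ * (1 - ε)) k / growth ρ k := fun k =>
      div_pos (growth_pos hs k) (growth_pos hρ k)
    have h := hbound n _ _ (fun k => (div_pos (hW0 _) (hW0 _)).le)
      (fun k => by split_ifs <;> norm_num)
      (isDiagSuperharmonic_below (m := m) hρ hε1 (fun k hk => hN k (by omega)) hW0 fun k => ?_)
      (by simpa using (div_self (hW0 m).ne').ge) (Set.Iic m) (fun y hy => by simp [Set.mem_Iic.1 hy])
    · rwa [max_eq_left hn] at h
    · have h1 := growth_pos hρ k
      rw [growth_succ, growth_succ]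
      push_cast
      field_simp
      ring
  · intro δ hδ0 hδ1
    have h1 : ∀ᶠ l : ℕ in atTop, ρ / (ρ + l) + upProb ρ l ≤ 1 / 2 := by
      have := hrate.add hup
      rw [add_zero] at this
      exact this.eventually_le_const (by norm_num)
    have h2 : ∀ᶠ l : ℕ in atTop, ρ / (ρ + (l + 1 : ℕ)) ≤ δ :=
      ((tendsto_add_atTop_iff_nat 1).2 hrate).eventually_le_const hδ0
    obtain ⟨N, hN⟩ := eventually_atTop.1 (h1.and h2)
    refine ⟨N, fun l hl n hn => ?_⟩
    have hB : ∀ k, growth ρ l / growth ρ (max k l) ≤ 1 := fun k =>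
      div_le_one_of_le₀ (growth_mono hρ (le_max_right _ _)) (growth_pos hρ _).le
    have h := hbound n _ _ (fun k => le_min zero_le_one (by linarith [hB k]))
      (fun k => by split_ifs <;> norm_num)
      (isDiagSuperharmonic_above hρ hδ0 hδ1 (hN l hl).1 (hN l hl).2)
      (by
        have := hB 0
        simpa using (show growth ρ l / growth ρ (max 0 l) ≤ δ + 1 by linarith))
      (Set.Ioi (l + 1)) (fun y hy => by simp [Set.mem_Ioi.1 hy])
    rw [max_eq_left hn] at h
    have hc : {ω | V n ω ∈ Set.Ioi (l + 1)} = {ω | V n ω ≤ l + 1}ᶜ := by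
      ext ω; simp
    rw [hc, probReal_compl_eq_one_sub (measurableSet_le (hV n) measurable_const)] at h
    have := h.trans (min_le_right _ _)
    linarith

theorem tendstoInDistribution_mouse {ρ : ℝ} (hρ : 0 < ρ) {Ω : ℕ → Type*}
    [∀ n, MeasurableSpace (Ω n)] {P : (n : ℕ) → Measure (Ω n)} [∀ n, IsProbabilityMeasure (P n)]
    {V : (n : ℕ) → Ω n → ℕ} (hV : ∀ n, Measurable (V n))
    (h : ∀ x : ℝ, 0 < x → x < 1 →
      Tendsto (fun n => (P n).real {ω | V n ω ≤ ⌊x * n⌋₊}) atTop (𝓝 (x ^ ρ))) :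
    TendstoInDistribution (fun n ω => (V n ω : ℝ) / n) atTop
      (fun u : unitInterval => (u : ℝ) ^ (1 / ρ)) P volume := by
  have hFm : Measurable fun u : unitInterval => (u : ℝ) ^ (1 / ρ) :=
    measurable_subtype_coe.pow_const _
  refine tendstoInDistribution_of_forall_tendsto_cdf
    (fun n => (measurable_from_top.comp (hV n)).div_const _) hFm ?_
  have hmid : ∀ x : ℝ, 0 < x → x < 1 →
      Tendsto (fun n => (P n).real {ω | (V n ω : ℝ) / n ≤ x}) atTop (𝓝 (x ^ ρ)) := by
    intro x hx0 hx1
    refine (h x hx0 hx1).congr' ?_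
    filter_upwards [eventually_gt_atTop 0] with n hn
    congr 1
    ext ω
    rw [Set.mem_ofPred_eq, Set.mem_ofPred_eq, div_le_iff₀ (by positivity),
      Nat.le_floor_iff (by positivity)]
  have hcont : Continuous fun y : ℝ => y ^ ρ := Real.continuous_rpow_const hρ.le
  have hmono : ∀ (n : ℕ) {x y : ℝ}, x ≤ y →
      (P n).real {ω | (V n ω : ℝ) / n ≤ x} ≤ (P n).real {ω | (V n ω : ℝ) / n ≤ y} :=
    fun n x y hxy => measureReal_mono fun ω hω => le_trans hω hxy
  intro x
  rcases lt_or_ge x 0 with hx | hx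
  · have e1 : {u : unitInterval | (u : ℝ) ^ (1 / ρ) ≤ x} = ∅ := by
      refine Set.eq_empty_of_forall_notMem fun u hu => ?_
      exact absurd (Real.rpow_nonneg u.2.1 (1 / ρ)) (not_le.2 (lt_of_le_of_lt hu hx))
    have e2 : ∀ n, {ω | (V n ω : ℝ) / n ≤ x} = ∅ := fun n => by
      refine Set.eq_empty_of_forall_notMem fun ω hω => ?_
      exact absurd (show (0 : ℝ) ≤ (V n ω : ℝ) / n by positivity)
        (not_le.2 (lt_of_le_of_lt hω hx))
    rw [e1]
    simp [e2]
  rcases hx.eq_or_lt with rfl | hx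
  -- The endpoint `0`, like `x ≥ 1` below, follows from interior points by monotonicity and
  -- continuity of `y ^ ρ`.
  · rw [volume_real_rpow_le hρ ⟨le_rfl, zero_le_one⟩, Real.zero_rpow hρ.ne']
    refine tendsto_order.2 ⟨fun c hc => Eventually.of_forall fun n =>
      lt_of_lt_of_le hc measureReal_nonneg, fun c hc => ?_⟩
    have h0 : Tendsto (fun y : ℝ => y ^ ρ) (𝓝[>] 0) (𝓝 0) := by
      have := hcont.tendsto 0
      rw [Real.zero_rpow hρ.ne'] at this
      exact this.mono_left nhdsWithin_le_nhds
    obtain ⟨y, hy, hy0, hy1⟩ := ((h0.eventually_lt_const hc).and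
      (Ioo_mem_nhdsGT (show (0 : ℝ) < 1 by norm_num))).exists
    filter_upwards [(hmid y hy0 hy1).eventually_lt_const hy] with n hn
    exact lt_of_le_of_lt (hmono n hy0.le) hn
  rcases lt_or_ge x 1 with hx1 | hx1
  · rw [volume_real_rpow_le hρ ⟨hx.le, hx1.le⟩]
    exact hmid x hx hx1
  · have e1 : {u : unitInterval | (u : ℝ) ^ (1 / ρ) ≤ x} = Set.univ :=
      Set.eq_univ_of_forall fun u =>
        (Real.rpow_le_one u.2.1 u.2.2 (by positivity)).trans hx1
    rw [e1, probReal_univ]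
    refine tendsto_order.2 ⟨fun c hc => ?_, fun c hc => Eventually.of_forall fun n =>
      lt_of_le_of_lt measureReal_le_one hc⟩
    have h0 : Tendsto (fun y : ℝ => y ^ ρ) (𝓝[<] 1) (𝓝 1) := by
      have := hcont.tendsto 1
      rw [Real.one_rpow] at this
      exact this.mono_left nhdsWithin_le_nhds
    obtain ⟨y, hy, hy0, hy1⟩ := ((h0.eventually_const_lt hc).and
      (Ioo_mem_nhdsLT (show (0 : ℝ) < 1 by norm_num))).exists
    filter_upwards [(hmid y hy0 hy1).eventually_const_lt hy] with n hn
    exact lt_of_lt_of_le hn (hmono n (hy1.le.trans hx1))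

end CatMouse

theorem mainTheorem11 (ρ : ℝ) (hρ : 0 < ρ)
    (Ω : ℕ → Type*) [∀ n, MeasurableSpace (Ω n)]
    (P : (n : ℕ) → Measure (Ω n)) [∀ n, IsProbabilityMeasure (P n)]
    (X : (n : ℕ) → ℝ≥0 → Ω n → ℕ × ℕ)
    (hX : ∀ n, CatMouse.IsMarkovJumpProcess
      (CatMouse.catMouseRate (CatMouse.mmInftyRate ρ)) (n, n) (P n) (X n)) :
    (∀ n, ∀ᵐ ω ∂(P n), ∃ s : ℝ≥0, 0 < s ∧ (X n s ω).1 = 0) ∧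
    ∃ (Ω' : Type) (_ : MeasurableSpace Ω') (P' : Measure Ω') (_ : IsProbabilityMeasure P')
      (F : Ω' → ℝ),
      (∀ ω, F ω ∈ Set.Icc (0 : ℝ) 1) ∧
      (∀ x ∈ Set.Icc (0 : ℝ) 1, P'.real {ω | F ω ≤ x} = x ^ ρ) ∧
      TendstoInDistribution
        (fun (n : ℕ) (ω : Ω n) => ((X n (CatMouse.catHitZero (X n) ω) ω).2 : ℝ) / (n : ℝ))
        atTop F P P' := by
  choose V hV hhit hVX hbound using fun n => (hX n).exists_mouse hρ
  refine ⟨hhit, unitInterval, inferInstance, volume, inferInstance,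
    fun u => (u : ℝ) ^ (1 / ρ), fun u => ⟨Real.rpow_nonneg u.2.1 _,
      Real.rpow_le_one u.2.1 u.2.2 (by positivity)⟩,
    fun x hx => CatMouse.volume_real_rpow_le hρ hx, ?_⟩
  refine (CatMouse.tendstoInDistribution_mouse hρ hV fun x hx0 hx1 =>
    CatMouse.tendsto_real_mouse_le hρ hV hbound hx0 hx1).congr (fun n => ?_) (ae_eq_refl _)
  filter_upwards [hVX n] with ω hω
  rw [hω]
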